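/- Let $\mathcal Y$ be a nonempty measurable space such that $\{x\in\mathbb R: f(x)=g(x)\}$ is measurable for all measurable $f,g:\mathbb R\to\mathcal Y$. For an integer $k\ge 1$, let $\mathcal F_k$ be the class of $k$-piecewise constant functions: those $f:\mathbb R\to\mathcal Y$ for which there are reals $t_1\le\dots\le t_{k-1}$ (put $t_0=-\infty$, $t_k=\infty$) such that $f$ is constant on $\{x\in\mathbb R: t_{i-1}<x\le t_i\}$ for each $i=1,\dots,k$. Let $P$ be the uniform distribution on $(0,1)$ and let $\mathrm{dist}(f,\mathcal F_k)=\inf_{g\in\mathcal F_k}P(x: f(x)\ne g(x))$. An $s$-sample $q$-query $\varepsilon$-tester for $\mathcal F_k$ is a randomized algorithm that draws $s$ points i.i.d. from $P$, sees all of these points, sequentially and adaptively queries the values of an unknown measurable function $f:\mathbb R\to\mathcal Y$ at no more than $q$ of them, and then accepts or rejects, in such a way that for every measurable $f$: if $f\in\mathcal F_k$, it accepts with probability at least $2/3$; if $\mathrm{dist}(f,\mathcal F_k)\ge\varepsilon$, it rejects with probability at least $2/3$. It is called active in the general case $q\le s$, and passive if $q=s$. There are absolute constants $C,c>0$ such that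 for all such $\mathcal Y$ and all $k\ge1$ the following hold. (1) For every $\varepsilon\in(0,1/2)$ there is an integer $s\le C\sqrt{k}/\varepsilon^5$ such that there exist an $s$-sample $q$-query (active) $\varepsilon$-tester for $\mathcal F_k$ with some $q\le\min\{s,\,C/\varepsilon^4\}$, and an $s$-sample $s$-query (passive) $\varepsilon$-tester for $\mathcal F_k$. (2) If $\mathcal Y$ has at least two elements and $\varepsilon\in(0,1/8)$, then every $s$-sample $s$-query (passive) $\varepsilon$-tester for $\mathcal F_k$ has $s\ge c\sqrt{k}$. -/

import Mathlib

open MeasureTheory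

universe u v

/-- The uniform distribution on `(0,1)`, as a measure on the real line. -/
noncomputable def uniform01 : Measure ℝ := volume.restrict (Set.Ioo 0 1)

/-- The breakpoints `t₀ = -∞`, `t₁, …, t_{k-1} ∈ ℝ`, `t_k = ∞`. -/
noncomputable def breakpoint (k : ℕ) (t : ℕ → ℝ) (i : ℕ) : EReal :=
  if i = 0 then ⊥ else if i < k then (t i : EReal) else ⊤

/-- The class of `k`-piecewise `H` functions: there are real `t₁ ≤ ⋯ ≤ t_{k-1}` and
`h₁, …, h_k ∈ H` with `f x = h_i x` whenever `t_{i-1} < x ≤ t_i`. (Used for `k ≥ 1`.) -/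
def piecewiseClass {Y : Type u} (k : ℕ) (H : Set (ℝ → Y)) : Set (ℝ → Y) :=
  {f | ∃ (t : ℕ → ℝ) (h : ℕ → ℝ → Y),
    (∀ i j, 1 ≤ i → i ≤ j → j < k → t i ≤ t j) ∧
    (∀ i, 1 ≤ i → i ≤ k → h i ∈ H) ∧
    ∀ i, 1 ≤ i → i ≤ k → ∀ x : ℝ,
      breakpoint k t (i - 1) < (x : EReal) → (x : EReal) ≤ breakpoint k t i → f x = h i x}

/-- The set of constant functions `ℝ → Y`. -/
def constantFunctions (Y : Type u) : Set (ℝ → Y) := Set.range fun y _ => y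

/-- The `L₀(P)` distance `P(x : f x ≠ g x)`. -/
noncomputable def dist0 {Y : Type u} (P : Measure ℝ) (f g : ℝ → Y) : ENNReal :=
  P {x | f x ≠ g x}

/-- The distance of `f` from a set `F` of functions. -/
noncomputable def distToClass {Y : Type u} (P : Measure ℝ) (f : ℝ → Y) (F : Set (ℝ → Y)) :
    ENNReal :=
  ⨅ g ∈ F, dist0 P f g

/-- Agreement sets of measurable functions into `Y` are measurable, that is, the distance
`P(x : f x ≠ g x)` is the probability of an event for all measurable `f` and `g`. -/
def MeasurableAgreement (Y : Type u) [MeasurableSpace Y] : Prop :=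
  ∀ f g : ℝ → Y, Measurable f → Measurable g → MeasurableSet {x | f x = g x}

/-- A sequential query strategy making at most `q` queries among `s` sample points:
either halt with a decision (`true` for accept, `false` for reject), or query the label of the
`i`-th sample point and continue depending on the answer. -/
inductive QueryTree (s : ℕ) (Y : Type u) : ℕ → Type u
  | halt {q : ℕ} (decision : Bool) : QueryTree s Y q
  | query {q : ℕ} (i : Fin s) (next : Y → QueryTree s Y q) : QueryTree s Y (q + 1)

/-- The decision reached by a query strategy when the sample points have labels `y`. -/
def QueryTree.run {s : ℕ} {Y : Type u} : {q : ℕ} → QueryTree s Y q → (Fin s → Y) → Bool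
  | _, .halt decision, _ => decision
  | _, .query i next, y => (next (y i)).run y

/-- A randomized algorithm with a sample of size `s` and at most `q` queries. Given its internal
random seed and the whole unlabeled sample, it follows a sequential query strategy. -/
structure SampleQueryAlgorithm (Y : Type u) (s q : ℕ) where
  Seed : Type v
  [measurableSpaceSeed : MeasurableSpace Seed]
  seedLaw : Measure Seed
  [isProbabilityMeasure_seedLaw : IsProbabilityMeasure seedLaw]
  strategy : Seed → (Fin s → ℝ) → QueryTree s Y q

namespace SampleQueryAlgorithm

attribute [instance] measurableSpaceSeed isProbabilityMeasure_seedLaw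

variable {Y : Type u} {s q : ℕ}

/-- The joint law of the seed and of the sample, which is i.i.d. from `P` and independent of the
seed. -/
noncomputable def law (A : SampleQueryAlgorithm.{u, v} Y s q) (P : Measure ℝ) :
    Measure (A.Seed × (Fin s → ℝ)) :=
  A.seedLaw.prod (Measure.pi fun _ => P)

/-- The event that the algorithm, run on the target function `f`, reaches the decision `b`. -/
def decisionEvent (A : SampleQueryAlgorithm.{u, v} Y s q) (f : ℝ → Y) (b : Bool) :
    Set (A.Seed × (Fin s → ℝ)) :=
  {p | (A.strategy p.1 p.2).run (fun i => f (p.2 i)) = b}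

/-- `A` is an `s`-sample `q`-query `ε`-tester for the class `F` under the distribution `P`. -/
def IsTester [MeasurableSpace Y] (A : SampleQueryAlgorithm.{u, v} Y s q) (ε : ℝ)
    (F : Set (ℝ → Y)) (P : Measure ℝ) : Prop :=
  ∀ f : ℝ → Y, Measurable f →
    (∀ b, MeasurableSet (A.decisionEvent f b)) ∧
    (f ∈ F → 2 / 3 ≤ A.law P (A.decisionEvent f true)) ∧
    (ENNReal.ofReal ε ≤ distToClass P f F → 2 / 3 ≤ A.law P (A.decisionEvent f false))

end SampleQueryAlgorithm

/-! Upper bound. The statistic is the probability that two points `x < y < x + δ` of `(0,1)` have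
different labels, with `δ = ε² / (80 k)`. If `f` has `k - 1` breakpoints, a shift by `e` changes `f`
on a set of measure at most `(k - 1) e`, and integrating over `e < δ` gives at most `(k - 1) δ² / 2`
(`volume_changePairs_le`). If `f` is `ε`-far, the statistic is at least `(k - 1 + 3 k ε / 8) δ² / 2`
(`le_volume_changePairs`). The reason is that rounding `x` up to a randomly offset grid of spacing
`d` yields a piecewise constant approximation of `f`. Surplus breakpoints can be merged away at cost
`1 / k` each, so an approximation within `ε / 2` of `f` must have more than `k - 1 + k ε / 2`
breakpoints. On average their number is at most `1 / d` times the measure of the shift changes.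

The gap is detected by splitting the sample into about `ε⁻⁴` blocks of two halves of size about `δ ^
(-1/2)`, and counting label changes over all near pairs across the two halves of a block. Only pairs
sharing a point are correlated, so the variance is of the order of the mean and Chebyshev's
inequality applies. Labels matter only at endpoints of near pairs, of which `O(ε⁻⁴)` are expected,
by a bound independent of `k`; querying just these gives the active tester.

Lower bound. Give each of `k` equal cells a bit, and compare the resulting step function with its
exclusive or with an alternating pattern of period `1 / (2 k)`. The first is in the class and the
second is `1/8`-far. For uniform bits the labels have the same law unless two sample points share a
cell, which has probability at most `s² / k`. -/

/-! ### Piecewise constant functions through finite sets of breakpoints -/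

/-- `f` is constant on the half-open intervals `(t, t']` cut out by the finite set `T`. -/
def CutBy {Y : Type u} (T : Finset ℝ) (f : ℝ → Y) : Prop :=
  ∀ x y, x ≤ y → (∀ t ∈ T, x ≤ t → y ≤ t) → f x = f y

theorem exists_cutBy_of_mem_piecewiseClass {Y : Type u} {k : ℕ} (hk : 1 ≤ k) {f : ℝ → Y}
    (hf : f ∈ piecewiseClass k (constantFunctions Y)) :
    ∃ T : Finset ℝ, T.card ≤ k - 1 ∧ CutBy T f := by
  classical
  obtain ⟨t, h, -, hH, hfh⟩ := hf
  refine ⟨(Finset.Ico 1 k).image t, Finset.card_image_le.trans (by simp), fun x y hxy hT => ?_⟩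
  have hex : ∃ i, (x : EReal) ≤ breakpoint k t i := ⟨k, by simp [breakpoint, show k ≠ 0 by omega]⟩
  have hspec := Nat.find_spec hex
  have hmin := fun j => Nat.find_min hex (m := j)
  set i := Nat.find hex
  have hi1 : 1 ≤ i := by
    by_contra h0
    have : i = 0 := by omega
    simp [this, breakpoint] at hspec
  have hik : i ≤ k := Nat.find_min' hex (by simp [breakpoint, show k ≠ 0 by omega])
  have hlt : breakpoint k t (i - 1) < (x : EReal) := lt_of_not_ge (hmin (i - 1) (by omega))
  have hy : (y : EReal) ≤ breakpoint k t i := by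
    have hi0 : i ≠ 0 := by omega
    by_cases hlk : i < k
    · simp only [breakpoint, hi0, if_false, hlk, if_true, EReal.coe_le_coe_iff] at hspec ⊢
      exact hT _ (Finset.mem_image_of_mem _ (by simp; omega)) hspec
    · simp [breakpoint, hi0, hlk]
  obtain ⟨c, hc⟩ := hH i hi1 hik
  rw [hfh i hi1 hik x hlt hspec,
    hfh i hi1 hik y (hlt.trans_le (EReal.coe_le_coe_iff.2 hxy)) hy, ← hc]

theorem CutBy.mem_piecewiseClass {Y : Type u} [Nonempty Y] {k : ℕ} (hk : 1 ≤ k) {f : ℝ → Y}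
    {T : Finset ℝ} (hT : T.card ≤ k - 1) (hf : CutBy T f) :
    f ∈ piecewiseClass k (constantFunctions Y) := by
  classical
  -- Superfluous breakpoints are harmless; padding gives exactly `k - 1` of them, to be listed in
  -- increasing order.
  obtain ⟨T', hsub, hcard⟩ := Infinite.exists_superset_card_eq T (k - 1) hT
  set o := T'.orderEmbOfFin hcard
  let t : ℕ → ℝ := fun i => if h : i - 1 < k - 1 then o ⟨i - 1, h⟩ else 0
  have hmono : ∀ i j, 1 ≤ i → i ≤ j → j < k → t i ≤ t j := by
    intro i j hi hij hj
    simp only [t]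
    rw [dif_pos (by omega), dif_pos (by omega)]
    exact o.monotone (by simp [Fin.le_def]; omega)
  have hrange : ∀ r ∈ T', ∃ j, 1 ≤ j ∧ j < k ∧ t j = r := by
    intro r hr
    have : r ∈ Set.range o := by rw [Finset.range_orderEmbOfFin]; exact hr
    obtain ⟨j, rfl⟩ := this
    exact ⟨j + 1, by omega, by omega, by simp [t]⟩
  have key : ∀ i, 1 ≤ i → i ≤ k → ∀ x y : ℝ, x ≤ y → breakpoint k t (i - 1) < (x : EReal) →
      (y : EReal) ≤ breakpoint k t i → f x = f y := by
    intro i hi hik x y hxy hx hy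
    refine hf x y hxy fun r hr hxr => ?_
    obtain ⟨j, hj1, hjk, rfl⟩ := hrange r (hsub hr)
    have hij : i ≤ j := by
      by_contra hlt
      have h1 : i - 1 ≠ 0 := by omega
      have h2 : i - 1 < k := by omega
      simp only [breakpoint, h1, h2, if_false, if_true, EReal.coe_lt_coe_iff] at hx
      have := hmono j (i - 1) hj1 (by omega) h2
      linarith
    have h1 : i ≠ 0 := by omega
    have h2 : i < k := by omega
    simp only [breakpoint, h1, h2, if_false, if_true, EReal.coe_le_coe_iff] at hy
    exact hy.trans (hmono i j hi hij hjk)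
  let good : ℕ → ℝ → Prop := fun i x =>
    breakpoint k t (i - 1) < (x : EReal) ∧ (x : EReal) ≤ breakpoint k t i
  -- The arbitrary value fills only pieces without points, where nothing is to be checked.
  refine ⟨t, fun i _ => if h : ∃ x, good i x then f h.choose else Classical.arbitrary Y, hmono,
    fun i _ _ => ⟨_, rfl⟩, fun i hi hik x hx hx' => ?_⟩
  have hex : ∃ x, good i x := ⟨x, hx, hx'⟩
  simp only [dif_pos hex]
  have hc := hex.choose_spec
  rcases le_total x hex.choose with h | h
  · exact key i hi hik _ _ h hx hc.2
  · exact (key i hi hik _ _ h hc.1 hx').symm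

instance : IsProbabilityMeasure uniform01 := ⟨by simp [uniform01]⟩

theorem uniform01_apply (A : Set ℝ) : uniform01 A = volume (A ∩ Set.Ioo 0 1) := by
  rw [uniform01, Measure.restrict_apply' measurableSet_Ioo]

theorem dist0_triangle {Y : Type u} (P : Measure ℝ) (f g h : ℝ → Y) :
    dist0 P f h ≤ dist0 P f g + dist0 P g h := by
  refine (measure_mono fun x hx => ?_).trans (measure_union_le _ _)
  by_contra hc
  simp only [Set.mem_union, Set.mem_ofPred_eq, not_or, not_not] at hc hx
  exact hx (hc.1.trans hc.2)

/-- The `N + 1` pieces ending at a breakpoint are disjoint, so one has mass at most `1 / (N + 1)`.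
Overwriting it with the value of the piece to its right makes its right endpoint redundant. -/
theorem CutBy.exists_merge {Y : Type u} (P : Measure ℝ) [IsProbabilityMeasure P]
    {g : ℝ → Y} {N : ℕ} {T : Finset ℝ} (hN : T.card = N + 1) (hg : CutBy T g) :
    ∃ (T' : Finset ℝ) (h : ℝ → Y), T'.card = N ∧ CutBy T' h ∧
      dist0 P g h ≤ ((N : ENNReal) + 1)⁻¹ := by
  classical
  let piece : ℝ → Set ℝ := fun t => {x | x ≤ t ∧ ∀ t' ∈ T, t' < t → t' < x}
  have hmeas : ∀ t, MeasurableSet (piece t) := by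
    intro t
    have : piece t = Set.Iic t ∩ ⋂ t' ∈ T, {x | t' < t → t' < x} := by
      ext x; simp [piece]
    rw [this]
    refine measurableSet_Iic.inter (Finset.measurableSet_biInter _ fun t' _ => ?_)
    by_cases h : t' < t
    · simp only [h, true_imp_iff]; exact measurableSet_Ioi
    · simp [h]
  have hdisj : (T : Set ℝ).PairwiseDisjoint piece := by
    intro a ha b hb hab
    refine Set.disjoint_left.2 fun x hxa hxb => ?_
    rcases lt_or_gt_of_ne hab with h | h
    · exact absurd (hxb.2 a ha h) (not_lt.2 hxa.1)
    · exact absurd (hxa.2 b hb h) (not_lt.2 hxb.1)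
  have hsum : ∑ t ∈ T, P (piece t) ≤ 1 := by
    rw [← measure_biUnion_finset hdisj fun t _ => hmeas t]
    exact prob_le_one
  obtain ⟨t, htT, ht⟩ : ∃ t ∈ T, P (piece t) ≤ ((N : ENNReal) + 1)⁻¹ := by
    by_contra hc
    push Not at hc
    have hne : T.Nonempty := Finset.card_pos.1 (by omega)
    have hlt : ∑ t ∈ T, ((N : ENNReal) + 1)⁻¹ < ∑ t ∈ T, P (piece t) :=
      ENNReal.sum_lt_sum_of_nonempty hne hc
    rw [Finset.sum_const, hN, nsmul_eq_mul, Nat.cast_add, Nat.cast_one,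
      ENNReal.mul_inv_cancel (by simp) (by finiteness)] at hlt
    exact absurd hsum (not_le.2 hlt)
  -- A point `z` of the piece just to the right of `t`.
  obtain ⟨z, htz, hz⟩ : ∃ z, t < z ∧ ∀ t' ∈ T, t < t' → z ≤ t' := by
    by_cases hne : (T.filter (t < ·)).Nonempty
    · refine ⟨(T.filter (t < ·)).min' hne, (Finset.mem_filter.1 (Finset.min'_mem _ hne)).2, ?_⟩
      exact fun t' h h' => Finset.min'_le _ _ (by simp [h, h'])
    · refine ⟨t + 1, by simp, fun t' h h' => absurd ⟨t', by simp [h, h']⟩ hne⟩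
  refine ⟨T.erase t, fun x => if x ∈ piece t then g z else g x, by simp [htT, hN], ?_, ?_⟩
  · intro x y hxy hT
    have hT' : ∀ t' ∈ T, t' ≠ t → x ≤ t' → y ≤ t' := fun t' h h' => hT t' (by simp [h, h'])
    by_cases hx : x ∈ piece t <;> by_cases hy : y ∈ piece t <;> simp only [hx, hy, if_true, if_false]
    · have hty : t < y := by
        by_contra hc
        exact hy ⟨not_lt.1 hc, fun t' h h' => (hx.2 t' h h').trans_le hxy⟩
      rcases le_total z y with h | h
      · refine hg z y h fun t' ht' hzt => hT' t' ht' (htz.trans_le hzt).ne' ?_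
        linarith [hx.1]
      · exact (hg y z h fun t' ht' hzt => hz t' ht' (hty.trans_le hzt)).symm
    · exfalso
      have : ∃ t' ∈ T, t' < t ∧ x ≤ t' := by
        by_contra hc
        push Not at hc
        exact hx ⟨hxy.trans hy.1, hc⟩
      obtain ⟨t', h1, h2, h3⟩ := this
      exact absurd (hy.2 t' h1 h2) (not_lt.2 (hT' t' h1 h2.ne h3))
    · refine hg x y hxy fun t' ht' hxt => ?_
      by_cases htt : t' = t
      · subst htt
        by_contra hc
        refine hx ⟨hxt, fun s hs hst => ?_⟩
        by_contra hsx
        have := hT' s hs hst.ne (not_lt.1 hsx)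
        linarith
      · exact hT' t' ht' htt hxt
  · refine (measure_mono fun x hx => ?_).trans ht
    by_contra hc
    simp [hc] at hx

/-- Merges are made only while there are at least `k` breakpoints, so each costs at most `1 / k`. -/
theorem CutBy.distToClass_le {Y : Type u} [Nonempty Y] (P : Measure ℝ) [IsProbabilityMeasure P]
    {k : ℕ} (hk : 1 ≤ k) (n : ℕ) :
    ∀ {g : ℝ → Y} {T : Finset ℝ}, T.card ≤ k - 1 + n → CutBy T g →
      ∃ h ∈ piecewiseClass k (constantFunctions Y), dist0 P g h ≤ n * (k : ENNReal)⁻¹ := by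
  induction n with
  | zero =>
    intro g T hT hg
    exact ⟨g, hg.mem_piecewiseClass hk hT, by simp [dist0]⟩
  | succ n ih =>
    intro g T hT hg
    by_cases hlt : T.card ≤ k - 1 + n
    · obtain ⟨h, hh, hd⟩ := ih hlt hg
      exact ⟨h, hh, hd.trans (by gcongr; simp)⟩
    obtain ⟨T', g', hT', hg', hd'⟩ := hg.exists_merge P (N := k - 1 + n) (by omega)
    obtain ⟨h, hh, hd⟩ := ih hT'.le hg'
    refine ⟨h, hh, (dist0_triangle P g g' h).trans ?_⟩
    have : ((k - 1 + n : ℕ) : ENNReal) + 1 ≥ k := by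
      norm_cast; omega
    calc _ ≤ (k : ENNReal)⁻¹ + n * (k : ENNReal)⁻¹ := add_le_add (hd'.trans (by gcongr)) hd
      _ = _ := by push_cast; ring

/-! ### Label changes under shifts -/

/-- The points of `(0, 1)` at which a shift by `e` stays in `(0, 1)` and changes the value. -/
def shiftChange {Y : Type u} (f : ℝ → Y) (e : ℝ) : Set ℝ :=
  {x | 0 < x ∧ x + e < 1 ∧ f x ≠ f (x + e)}

theorem CutBy.volume_shiftChange_le {Y : Type u} {f : ℝ → Y} {T : Finset ℝ} (hf : CutBy T f)
    {e : ℝ} (he : 0 ≤ e) : volume (shiftChange f e) ≤ T.card * ENNReal.ofReal e := by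
  calc volume (shiftChange f e) ≤ volume (⋃ t ∈ T, Set.Ioc (t - e) t) := by
        refine measure_mono fun x hx => ?_
        by_contra hc
        refine hx.2.2 (hf _ _ (by linarith) fun t ht hxt => ?_)
        simp only [Set.mem_iUnion, Set.mem_Ioc, not_exists, not_and, exists_prop] at hc
        by_contra h
        exact hc t ht (by linarith) hxt
    _ ≤ ∑ t ∈ T, volume (Set.Ioc (t - e) t) := measure_biUnion_finset_le _ _
    _ = _ := by simp

/-- The hypothesis concerns functions of one real variable; a Borel isomorphism between the plane
and the line transfers it to `f ∘ Prod.fst` and `f ∘ Prod.snd`. -/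
theorem MeasurableAgreement.measurableSet_prod {Y : Type u} [MeasurableSpace Y]
    (hY : MeasurableAgreement Y) {f : ℝ → Y} (hf : Measurable f) :
    MeasurableSet {p : ℝ × ℝ | f p.1 ≠ f p.2} := by
  have hc : ¬ Countable (ℝ × ℝ) := fun h =>
    not_countable (α := ℝ) ((Prod.fst_surjective (α := ℝ) (β := ℝ)).countable)
  let e : ℝ × ℝ ≃ᵐ ℝ := PolishSpace.measurableEquivOfNotCountable hc (not_countable_iff.2 inferInstance)
  have h := hY (fun z => f (e.symm z).1) (fun z => f (e.symm z).2)
    (hf.comp (measurable_fst.comp e.symm.measurable))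
    (hf.comp (measurable_snd.comp e.symm.measurable))
  have h2 := e.measurable h
  convert h2.compl using 1
  ext p
  simp

/-- The pairs of points of `(0, 1)`, in increasing order and at distance less than `d`, at which
`f` takes different values. -/
def changePairs {Y : Type u} (f : ℝ → Y) (d : ℝ) : Set (ℝ × ℝ) :=
  {p | 0 < p.1 ∧ p.2 < 1 ∧ p.1 < p.2 ∧ p.2 < p.1 + d ∧ f p.1 ≠ f p.2}

theorem measurableSet_changePairs {Y : Type u} [MeasurableSpace Y] (hY : MeasurableAgreement Y)
    {f : ℝ → Y} (hf : Measurable f) (d : ℝ) : MeasurableSet (changePairs f d) := by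
  refine (measurableSet_lt measurable_const measurable_fst).inter
    ((measurableSet_lt measurable_snd measurable_const).inter
    ((measurableSet_lt measurable_fst measurable_snd).inter
    ((measurableSet_lt measurable_snd (measurable_fst.add_const d)).inter
      (hY.measurableSet_prod hf))))

theorem measurableSet_shiftChange {Y : Type u} [MeasurableSpace Y] (hY : MeasurableAgreement Y)
    {f : ℝ → Y} (hf : Measurable f) (e : ℝ) : MeasurableSet (shiftChange f e) := by
  refine (measurableSet_lt measurable_const measurable_id).inter
    ((measurableSet_lt (measurable_id.add_const e) measurable_const).inter ?_)
  exact (measurable_id.prodMk (measurable_id.add_const e)) (hY.measurableSet_prod hf)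

/-- The shear `(x, e) ↦ (x, x + e)` preserves area, so Fubini's theorem slices the set by the gap
`e`. -/
theorem volume_changePairs {Y : Type u} [MeasurableSpace Y] (hY : MeasurableAgreement Y)
    {f : ℝ → Y} (hf : Measurable f) (d : ℝ) :
    volume (changePairs f d) = ∫⁻ e in Set.Ioo 0 d, volume (shiftChange f e) := by
  have hW := measurableSet_changePairs hY hf d
  let φ : ℝ × ℝ → ℝ × ℝ := fun p => (p.1, p.1 + p.2)
  have hφ : Measurable φ := measurable_fst.prodMk (measurable_fst.add measurable_snd)
  have h1 : volume (φ ⁻¹' changePairs f d) = volume (changePairs f d) := by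
    rw [Measure.volume_eq_prod, Measure.prod_apply hW, Measure.prod_apply (hφ hW)]
    refine lintegral_congr fun x => ?_
    rw [← measure_preimage_add volume x (Prod.mk x ⁻¹' changePairs f d)]
    rfl
  rw [← h1, Measure.volume_eq_prod, Measure.prod_apply_symm (hφ hW),
    ← lintegral_indicator measurableSet_Ioo]
  refine lintegral_congr fun e => ?_
  by_cases he : e ∈ Set.Ioo 0 d
  · rw [Set.indicator_of_mem he]
    congr 1
    ext x
    have h1 := he.1
    have h2 := he.2
    simp [φ, changePairs, shiftChange, h1, h2]
  · rw [Set.indicator_of_notMem he]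
    convert measure_empty (μ := (volume : Measure ℝ))
    ext x
    simp only [φ, changePairs, Set.mem_preimage, Set.mem_ofPred_eq, Set.mem_empty_iff_false,
      iff_false]
    rintro ⟨-, -, h1, h2, -⟩
    exact he ⟨by linarith, by linarith⟩

/-- A change over distance `j d` forces a change over one of the `j` consecutive steps of length
`d`. -/
theorem volume_shiftChange_mul_le {Y : Type u} (f : ℝ → Y) {d : ℝ} (hd : 0 ≤ d) (j : ℕ) :
    volume (shiftChange f (j * d)) ≤ j * volume (shiftChange f d) := by
  induction j with
  | zero => simp [shiftChange]
  | succ j ih =>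
    calc volume (shiftChange f ((j + 1 : ℕ) * d))
        ≤ volume (shiftChange f (j * d) ∪ (fun x => x + j * d) ⁻¹' shiftChange f d) := by
          refine measure_mono fun x ⟨h1, h2, h3⟩ => ?_
          have hj : 0 ≤ (j : ℝ) * d := by positivity
          have hx : x + (j + 1 : ℕ) * d = x + j * d + d := by push_cast; ring
          rw [hx] at h2 h3
          by_contra hc
          simp only [Set.mem_union, Set.mem_preimage, shiftChange, Set.mem_ofPred_eq, not_or,
            not_and, not_not] at hc
          exact h3 ((hc.1 h1 (by linarith)).trans (hc.2 (by linarith) h2))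
      _ ≤ volume (shiftChange f (j * d)) + volume ((fun x => x + j * d) ⁻¹' shiftChange f d) :=
          measure_union_le _ _
      _ ≤ j * volume (shiftChange f d) + volume (shiftChange f d) := by
          rw [measure_preimage_add_right]; gcongr
      _ = _ := by push_cast; ring

theorem lintegral_ofReal_mul_Ioo {b d : ℝ} (hb : 0 ≤ b) (hd : 0 ≤ d) :
    ∫⁻ e in Set.Ioo 0 d, ENNReal.ofReal (b * e) = ENNReal.ofReal (b * d ^ 2 / 2) := by
  rw [← ofReal_integral_eq_lintegral_ofReal]
  · rw [← integral_Ioc_eq_integral_Ioo, ← intervalIntegral.integral_of_le hd,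
      intervalIntegral.integral_const_mul, integral_id]
    congr 1; ring
  · have : IntegrableOn (fun e : ℝ => b * e) (Set.Icc 0 d) :=
      (by fun_prop : Continuous fun e : ℝ => b * e).integrableOn_Icc
    exact this.mono_set Set.Ioo_subset_Icc_self
  · filter_upwards [self_mem_ae_restrict measurableSet_Ioo] with e he
    exact mul_nonneg hb he.1.le

theorem volume_changePairs_le {Y : Type u} [MeasurableSpace Y] (hY : MeasurableAgreement Y)
    {f : ℝ → Y} (hf : Measurable f) {k : ℕ} (hk : 1 ≤ k)
    (hfk : f ∈ piecewiseClass k (constantFunctions Y)) {d : ℝ} (hd : 0 ≤ d) :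
    volume (changePairs f d) ≤ ENNReal.ofReal (((k : ℝ) - 1) * d ^ 2 / 2) := by
  obtain ⟨T, hT, hcut⟩ := exists_cutBy_of_mem_piecewiseClass hk hfk
  have hk1 : ((k - 1 : ℕ) : ℝ) = k - 1 := by push_cast [hk]; ring
  have hk0 : (0 : ℝ) ≤ k - 1 := by rw [← hk1]; positivity
  rw [volume_changePairs hY hf, ← lintegral_ofReal_mul_Ioo hk0 hd]
  refine setLIntegral_mono' measurableSet_Ioo fun e he => ?_
  refine (hcut.volume_shiftChange_le he.1.le).trans ?_
  rw [ENNReal.ofReal_mul hk0, ← hk1, ENNReal.ofReal_natCast]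
  gcongr

/-! ### Random grids and the lower bound for functions far from the class -/

/-- Averaging over the offset of a grid of spacing `d`. -/
theorem lintegral_sum_grid_le {G : ℝ → ENNReal} (hG : Measurable G) (d : ℝ) (N : ℕ) :
    ∫⁻ z in Set.Ioo 0 d, ∑ j ∈ Finset.range N, G (z + j * d) ≤ ∫⁻ z, G z := by
  rw [lintegral_finsetSum _ fun (j : ℕ) _ => by fun_prop]
  have h1 : ∀ j : ℕ, ∫⁻ z in Set.Ioo 0 d, G (z + j * d) =
      ∫⁻ z in Set.Ioo (j * d) (j * d + d), G z := by
    intro j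
    rw [← lintegral_indicator measurableSet_Ioo, ← lintegral_indicator measurableSet_Ioo,
      ← lintegral_add_right_eq_self ((Set.Ioo ((j : ℝ) * d) (j * d + d)).indicator G) (j * d)]
    refine lintegral_congr fun z => ?_
    by_cases hz : z ∈ Set.Ioo 0 d
    · have hz' : z + j * d ∈ Set.Ioo ((j : ℝ) * d) (j * d + d) :=
        ⟨by linarith [hz.1], by linarith [hz.2]⟩
      rw [Set.indicator_of_mem hz, Set.indicator_of_mem hz']
    · rw [Set.indicator_of_notMem hz, Set.indicator_of_notMem]
      exact fun h => hz ⟨by linarith [h.1], by linarith [h.2]⟩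
  simp_rw [h1]
  have hdis : ((Finset.range N : Finset ℕ) : Set ℕ).PairwiseDisjoint
      fun j => Set.Ioo ((j : ℝ) * d) (j * d + d) := by
    have key : ∀ a b : ℕ, a < b → Disjoint (Set.Ioo ((a : ℝ) * d) (a * d + d))
        (Set.Ioo ((b : ℝ) * d) (b * d + d)) := by
      intro a b hab
      refine Set.disjoint_left.2 fun x hx hx' => ?_
      have hd : 0 < d := by linarith [hx.1, hx.2]
      have : ((a : ℝ) + 1) ≤ b := by exact_mod_cast hab
      have := mul_le_mul_of_nonneg_right this hd.le
      linarith [hx.2, hx'.1]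
    intro a _ b _ hab
    rcases lt_or_gt_of_ne hab with h | h
    · exact key a b h
    · exact (key b a h).symm
  rw [← lintegral_biUnion_finset hdis fun _ _ => measurableSet_Ioo]
  exact setLIntegral_le_lintegral _ _

/-- The points `x` forming with `z` an element of `changePairs f d`. -/
def changesBefore {Y : Type u} (f : ℝ → Y) (d z : ℝ) : Set ℝ :=
  {x | (x, z) ∈ changePairs f d}

open Classical in
/-- A grid of spacing `d` and offset `z` yields a piecewise constant approximation of `f`. -/
theorem exists_cutBy_grid {Y : Type u} (f : ℝ → Y) {d z : ℝ} (hd : d < 1) (hz : z ∈ Set.Ioo 0 d) :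
    ∃ (T : Finset ℝ) (g : ℝ → Y), CutBy T g ∧
      ((T.card : ENNReal) ≤ ∑ j ∈ Finset.range ⌈1 / d⌉₊,
        (shiftChange f d).indicator 1 (z + j * d)) ∧
      dist0 uniform01 f g ≤ ENNReal.ofReal d +
        ∑ j ∈ Finset.range ⌈1 / d⌉₊, volume (changesBefore f d (z + j * d)) := by
  obtain ⟨hz0, hzd⟩ := hz
  have hd0 : 0 < d := hz0.trans hzd
  obtain ⟨J, hJ1, hJ2⟩ : ∃ J : ℕ, z + J * d < 1 ∧ 1 ≤ z + (J + 1) * d := by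
    have hpos : 0 < (1 - z) / d := by apply div_pos <;> linarith
    have hc : 0 < ⌈(1 - z) / d⌉₊ := Nat.ceil_pos.2 hpos
    refine ⟨⌈(1 - z) / d⌉₊ - 1, ?_, ?_⟩
    · have : ((⌈(1 - z) / d⌉₊ - 1 : ℕ) : ℝ) < (1 - z) / d := by
        rw [← Nat.lt_ceil]; omega
      rw [lt_div_iff₀ hd0] at this
      linarith
    · have : (1 - z) / d ≤ ((⌈(1 - z) / d⌉₊ - 1 : ℕ) : ℝ) + 1 := by
        have := Nat.le_ceil ((1 - z) / d)
        rw [← Nat.cast_add_one]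
        rwa [Nat.sub_add_cancel hc]
      rw [div_le_iff₀ hd0] at this
      linarith
  have hJN : J < ⌈1 / d⌉₊ := by
    rw [Nat.lt_ceil, lt_div_iff₀ hd0]; linarith
  -- Rounding up to the next grid point. The cap `J` keeps that point below `1` and matters only for
  -- points within `d` of `1`.
  let idx : ℝ → ℕ := fun x => min ⌈(x - z) / d⌉₊ J
  let g : ℝ → Y := fun x => f (z + idx x * d)
  have hstep : ∀ j : ℕ, z + (j + 1 : ℕ) * d = z + j * d + d := fun j => by push_cast; ring
  -- A grid point is a breakpoint only if `f` differs at the next grid point.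
  refine ⟨((Finset.range J).filter fun j : ℕ => f (z + j * d) ≠ f (z + (j + 1 : ℕ) * d)).image
    fun j : ℕ => z + j * d, g, ?_, ?_, ?_⟩
  · intro x y hxy hT
    have hmono : idx x ≤ idx y := by
      refine min_le_min_right _ (Nat.ceil_mono ?_)
      gcongr
    have key : ∀ j, idx x ≤ j → j ≤ idx y → f (z + idx x * d) = f (z + j * d) := by
      intro j hj
      induction j, hj using Nat.le_induction with
      | base => intro _; rfl
      | succ j hj ih =>
        intro hjy
        rw [ih (by omega)]
        by_contra hne
        have hjJ : j < J := by have : idx y ≤ J := min_le_right _ _; omega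
        have h1 : x ≤ z + j * d := by
          have : ⌈(x - z) / d⌉₊ ≤ j := by
            simp only [idx] at hj; omega
          rw [Nat.ceil_le, div_le_iff₀ hd0] at this
          linarith
        have h2 : z + j * d < y := by
          have : j < ⌈(y - z) / d⌉₊ := by
            have : idx y ≤ ⌈(y - z) / d⌉₊ := min_le_left _ _
            omega
          rw [Nat.lt_ceil, lt_div_iff₀ hd0] at this
          linarith
        exact absurd (hT _ (Finset.mem_image.2 ⟨j, by simpa [hjJ] using hne, rfl⟩) h1)
          (not_le.2 h2)
    exact key _ hmono le_rfl
  · calc _ ≤ ((((Finset.range J).filter fun j : ℕ =>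
          f (z + j * d) ≠ f (z + (j + 1 : ℕ) * d)).card : ℕ) : ENNReal) := by
          exact_mod_cast Finset.card_image_le
      _ = ∑ j ∈ Finset.range J, if f (z + j * d) ≠ f (z + (j + 1 : ℕ) * d) then 1 else 0 := by
          rw [Finset.card_filter]; push_cast; rfl
      _ ≤ ∑ j ∈ Finset.range J, (shiftChange f d).indicator 1 (z + j * d) := by
          refine Finset.sum_le_sum fun j hj => ?_
          split_ifs with h
          · rw [Set.indicator_of_mem]
            · rfl
            · refine ⟨by positivity, ?_, by rwa [hstep] at h⟩
              have : ((j : ℝ) + 1) ≤ J := by exact_mod_cast Finset.mem_range.1 hj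
              have := mul_le_mul_of_nonneg_right this hd0.le
              linarith
          · exact zero_le
      _ ≤ _ := Finset.sum_le_sum_of_subset (Finset.range_mono hJN.le)
  · rw [dist0, uniform01_apply]
    calc _ ≤ volume (Set.Ioo (1 - d) 1 ∪ ⋃ j ∈ Finset.range ⌈1 / d⌉₊,
          changesBefore f d (z + j * d)) := by
          refine measure_mono fun x ⟨hx, hx0, hx1⟩ => ?_
          by_cases hxJ : x ≤ z + J * d
          · right
            have hle : ⌈(x - z) / d⌉₊ ≤ J := by
              rw [Nat.ceil_le, div_le_iff₀ hd0]; linarith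
            have hidx : idx x = ⌈(x - z) / d⌉₊ := min_eq_left hle
            have hxle : x ≤ z + idx x * d := by
              have := Nat.le_ceil ((x - z) / d)
              rw [div_le_iff₀ hd0] at this
              rw [hidx]; linarith
            have hlt : z + idx x * d < x + d := by
              rw [hidx]
              rcases Nat.eq_zero_or_pos ⌈(x - z) / d⌉₊ with h | h
              · rw [h]; simp; linarith
              · have := Nat.ceil_lt_add_one (Nat.ceil_pos.1 h).le
                have := mul_lt_mul_of_pos_right this hd0
                rw [add_mul, div_mul_cancel₀ _ hd0.ne'] at this
                linarith
            have hne : x ≠ z + idx x * d := fun h => hx (congrArg f h)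
            have hJ' : (idx x : ℝ) ≤ J := by exact_mod_cast hidx ▸ hle
            have := mul_le_mul_of_nonneg_right hJ' hd0.le
            refine Set.mem_iUnion₂.2 ⟨idx x, Finset.mem_range.2 ((hidx ▸ hle).trans_lt hJN), ?_⟩
            exact ⟨hx0, by simpa using (by linarith : z + idx x * d < 1),
              lt_of_le_of_ne hxle hne, hlt, hx⟩
          · left
            exact ⟨by linarith, hx1⟩
      _ ≤ volume (Set.Ioo (1 - d) 1) + volume (⋃ j ∈ Finset.range ⌈1 / d⌉₊,
          changesBefore f d (z + j * d)) := measure_union_le _ _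
      _ ≤ _ := by
          gcongr
          · simp
          · exact measure_biUnion_finset_le _ _

/-- Averaged over the offset `z`, either the grid approximation has at least `b` breakpoints,
charged to the first term, or it is at distance at least `ε / 2` from `f`. The latter is charged to
the second term, where the factor `2 b / ε` turns distance `ε / 2` into `b`. -/
theorem ofReal_mul_le_volume_shiftChange_add {Y : Type u} [MeasurableSpace Y] [Nonempty Y]
    (hY : MeasurableAgreement Y) {f : ℝ → Y} (hf : Measurable f) {k : ℕ} (hk : 1 ≤ k)
    {ε : ℝ} (hε : 0 < ε)
    (hfar : ENNReal.ofReal ε ≤ distToClass uniform01 f (piecewiseClass k (constantFunctions Y)))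
    {d : ℝ} (hd0 : 0 < d) (hd1 : d < 1) {b : ℝ} (hb : b = k - 1 + k * ε / 2) :
    ENNReal.ofReal (b * d) ≤ volume (shiftChange f d) +
      ENNReal.ofReal (2 * b / ε) * (ENNReal.ofReal (d ^ 2) + volume (changePairs f d)) := by
  classical
  have hkR : (1 : ℝ) ≤ k := by exact_mod_cast hk
  have hb0 : 0 < b := by rw [hb]; nlinarith
  have hW := measurableSet_changePairs hY hf d
  let H : ℝ → ENNReal := fun z => volume (changesBefore f d z)
  have hH : Measurable H := measurable_measure_prodMk_right hW
  have hHint : ∫⁻ z, H z = volume (changePairs f d) := by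
    rw [Measure.volume_eq_prod, Measure.prod_apply_symm hW]; rfl
  let S : ℝ → ENNReal := (shiftChange f d).indicator 1
  have hS : Measurable S := measurable_one.indicator (measurableSet_shiftChange hY hf d)
  have hSint : ∫⁻ z, S z = volume (shiftChange f d) := by
    simp only [S]
    rw [lintegral_indicator_one (measurableSet_shiftChange hY hf d)]
  set N := ⌈1 / d⌉₊
  have hpt : ∀ z ∈ Set.Ioo 0 d, ENNReal.ofReal b ≤ ∑ j ∈ Finset.range N, S (z + j * d) +
      ENNReal.ofReal (2 * b / ε) *
        (ENNReal.ofReal d + ∑ j ∈ Finset.range N, H (z + j * d)) := by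
    intro z hz
    obtain ⟨T, g, hcut, hcard, hdist⟩ := exists_cutBy_grid f hd1 hz
    refine le_trans ?_ (add_le_add hcard (mul_le_mul_right hdist _))
    by_cases hbig : ENNReal.ofReal (ε / 2) ≤ dist0 uniform01 f g
    · calc ENNReal.ofReal b = ENNReal.ofReal (2 * b / ε) * ENNReal.ofReal (ε / 2) := by
            rw [← ENNReal.ofReal_mul (by positivity)]; congr 1; field_simp
        _ ≤ ENNReal.ofReal (2 * b / ε) * dist0 uniform01 f g := by gcongr
        _ ≤ _ := le_add_self
    · push Not at hbig
      refine le_trans ?_ le_self_add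
      -- Merging the surplus breakpoints must cost more than `ε / 2`, so there are more than `k ε /
      -- 2` of them.
      obtain ⟨h, hh, hgh⟩ := hcut.distToClass_le uniform01 hk (T.card - (k - 1)) (by omega)
      have h1 : ENNReal.ofReal ε ≤ dist0 uniform01 f h :=
        hfar.trans (iInf₂_le h hh)
      have h2 : ENNReal.ofReal (ε / 2) + ENNReal.ofReal (ε / 2) <
          ENNReal.ofReal (ε / 2) + ((T.card - (k - 1) : ℕ) : ENNReal) * (k : ENNReal)⁻¹ := by
        rw [← ENNReal.ofReal_add (by positivity) (by positivity), add_halves]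
        refine (h1.trans (dist0_triangle _ f g h)).trans_lt ?_
        exact ENNReal.add_lt_add_of_lt_of_le (ne_top_of_le_ne_top (by finiteness) hgh) hbig hgh
      have h3 := lt_of_add_lt_add_left h2
      have hk0 : (0 : ℝ) < k := by linarith
      have h4 : ((T.card - (k - 1) : ℕ) : ENNReal) * (k : ENNReal)⁻¹ =
          ENNReal.ofReal ((T.card - (k - 1) : ℕ) * (k : ℝ)⁻¹) := by
        rw [ENNReal.ofReal_mul (by positivity), ENNReal.ofReal_natCast,
          ENNReal.ofReal_inv_of_pos hk0, ENNReal.ofReal_natCast]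
      rw [h4, ENNReal.ofReal_lt_ofReal_iff_of_nonneg (by positivity), ← div_eq_mul_inv,
        lt_div_iff₀ hk0] at h3
      have h5 : k - 1 ≤ T.card := by
        by_contra hc
        rw [Nat.sub_eq_zero_of_le (by omega)] at h3
        have : 0 < ε / 2 * k := by positivity
        simp at h3; linarith
      rw [Nat.cast_sub h5, Nat.cast_sub hk] at h3
      rw [← ENNReal.ofReal_natCast]
      refine ENNReal.ofReal_le_ofReal ?_
      rw [hb]; push_cast at h3; linarith
  calc ENNReal.ofReal (b * d) = ∫⁻ _ in Set.Ioo 0 d, ENNReal.ofReal b := by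
        rw [setLIntegral_const, Real.volume_Ioo, sub_zero, ENNReal.ofReal_mul hb0.le]
    _ ≤ ∫⁻ z in Set.Ioo 0 d, (∑ j ∈ Finset.range N, S (z + j * d) +
        ENNReal.ofReal (2 * b / ε) *
          (ENNReal.ofReal d + ∑ j ∈ Finset.range N, H (z + j * d))) :=
        setLIntegral_mono' measurableSet_Ioo hpt
    _ = (∫⁻ z in Set.Ioo 0 d, ∑ j ∈ Finset.range N, S (z + j * d)) +
        ENNReal.ofReal (2 * b / ε) * (ENNReal.ofReal (d ^ 2) +
          ∫⁻ z in Set.Ioo 0 d, ∑ j ∈ Finset.range N, H (z + j * d)) := by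
        rw [lintegral_add_left (by fun_prop), lintegral_const_mul _ (by fun_prop),
          lintegral_add_left (by fun_prop), setLIntegral_const, Real.volume_Ioo, sub_zero,
          ← ENNReal.ofReal_mul hd0.le, sq]
    _ ≤ _ := by
        rw [← hHint, ← hSint]
        exact add_le_add (lintegral_sum_grid_le hS d N)
          (mul_le_mul_right (add_le_add_right (lintegral_sum_grid_le hH d N) _) _)

theorem le_volume_changePairs {Y : Type u} [MeasurableSpace Y] [Nonempty Y]
    (hY : MeasurableAgreement Y) {f : ℝ → Y} (hf : Measurable f) {k : ℕ} (hk : 1 ≤ k)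
    {ε : ℝ} (hε : 0 < ε) (hε1 : ε < 1 / 2)
    (hfar : ENNReal.ofReal ε ≤ distToClass uniform01 f (piecewiseClass k (constantFunctions Y)))
    {δ : ℝ} (hδ : δ = ε ^ 2 / (80 * k)) :
    ENNReal.ofReal ((k - 1 + 3 * k * ε / 8) * δ ^ 2 / 2) ≤ volume (changePairs f δ) := by
  have hkR : (1 : ℝ) ≤ k := by exact_mod_cast hk
  have hδ0 : 0 < δ := by rw [hδ]; positivity
  have hkδ : k * δ = ε ^ 2 / 80 := by rw [hδ]; field_simp
  have hδ1 : δ < 1 := by nlinarith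
  -- A volume of at least `k δ²` already suffices. Otherwise the error term in the grid inequality
  -- is small.
  by_cases hbig : ENNReal.ofReal (k * δ ^ 2) ≤ volume (changePairs f δ)
  · refine le_trans (ENNReal.ofReal_le_ofReal ?_) hbig
    have : k - 1 + 3 * k * ε / 8 ≤ 2 * (k : ℝ) := by nlinarith
    have := mul_le_mul_of_nonneg_right this (sq_nonneg δ)
    linarith
  push Not at hbig
  set c : ℝ := k - 1 + 3 * k * ε / 8 with hc
  have hc0 : 0 ≤ c := by
    have : 0 ≤ 3 * k * ε / 8 := by positivity
    linarith
  have hlarge : ∀ d, δ / 2 ≤ d → d ≤ δ → ENNReal.ofReal (c * d) ≤ volume (shiftChange f d) := by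
    intro d hd1 hd2
    have hd0 : 0 < d := by linarith
    set b : ℝ := k - 1 + k * ε / 2 with hb
    have hb0 : 0 < b := by nlinarith
    have hb1 : b ≤ 5 / 4 * k := by nlinarith
    have hmain := ofReal_mul_le_volume_shiftChange_add hY hf hk hε hfar hd0 (by linarith) hb
    have hsub : volume (changePairs f d) ≤ ENNReal.ofReal (k * δ ^ 2) := by
      refine le_trans (measure_mono fun p ⟨h1, h2, h3, h4, h5⟩ => ?_) hbig.le
      exact ⟨h1, h2, h3, by linarith, h5⟩
    have h2 : ENNReal.ofReal (2 * b / ε) *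
        (ENNReal.ofReal (d ^ 2) + volume (changePairs f d)) ≤
        ENNReal.ofReal (2 * b / ε * (d ^ 2 + k * δ ^ 2)) := by
      rw [ENNReal.ofReal_mul (by positivity), ENNReal.ofReal_add (by positivity) (by positivity)]
      gcongr
    have h3 := hmain.trans (add_le_add le_rfl h2)
    rw [← tsub_le_iff_right, ← ENNReal.ofReal_sub _ (by positivity)] at h3
    refine le_trans (ENNReal.ofReal_le_ofReal ?_) h3
    have h4 : d ^ 2 + k * δ ^ 2 ≤ 4 * (k * δ) * d := by nlinarith [mul_pos hδ0 hd0]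
    -- This fixes the constant in `δ`: since `k δ = ε² / 80`, the error is `k ε d / 8`, which lowers
    -- the surplus from `k ε / 2` to `3 k ε / 8`.
    have h5 : 2 * b / ε * (d ^ 2 + k * δ ^ 2) ≤ k * ε / 8 * d := by
      calc 2 * b / ε * (d ^ 2 + k * δ ^ 2) ≤ 2 * (5 / 4 * k) / ε * (4 * (k * δ) * d) := by gcongr
        _ = _ := by rw [hkδ]; field_simp; ring
    have h6 : c * d = b * d - k * ε / 8 * d := by rw [hc, hb]; ring
    linarith
  have hall : ∀ d ∈ Set.Ioo 0 δ, ENNReal.ofReal (c * d) ≤ volume (shiftChange f d) := by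
    intro d ⟨hd0, hdδ⟩
    -- The multiple `j d` lies in `[δ / 2, δ]`, so subadditivity carries the bound down to small
    -- `d`.
    set j := ⌊δ / d⌋₊
    have hj1 : (j : ℝ) * d ≤ δ := by
      rw [← le_div_iff₀ hd0]; exact Nat.floor_le (by positivity)
    have hj0 : 1 ≤ j := Nat.le_floor (by rw [le_div_iff₀ hd0]; simpa using hdδ.le)
    have hj2 : δ / 2 ≤ j * d := by
      have h1 : δ / d < j + 1 := Nat.lt_floor_add_one _
      rw [div_lt_iff₀ hd0] at h1
      have : (1 : ℝ) ≤ j := by exact_mod_cast hj0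
      nlinarith
    have h := (hlarge _ hj2 hj1).trans (volume_shiftChange_mul_le f hd0.le j)
    rw [show c * (j * d) = j * (c * d) by ring, ENNReal.ofReal_mul (by positivity),
      ENNReal.ofReal_natCast] at h
    exact (ENNReal.mul_le_mul_iff_right (by simp; omega) (by simp)).1 h
  rw [volume_changePairs hY hf, ← lintegral_ofReal_mul_Ioo hc0 hδ0.le]
  exact setLIntegral_mono' measurableSet_Ioo hall

/-! ### Second moments of edge counts on an i.i.d. sample -/

open ProbabilityTheory in
theorem iIndepFun_sample {V : Type*} [Fintype V] (P : Measure ℝ) [IsProbabilityMeasure P] :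
    iIndepFun (fun (i : V) (x : V → ℝ) => x i) (Measure.pi fun _ : V => P) :=
  iIndepFun_pi (X := fun _ => id) fun _ => aemeasurable_id

theorem map_sample_pair {V : Type*} [Fintype V] (P : Measure ℝ) [IsProbabilityMeasure P] {i j : V}
    (hij : i ≠ j) : (Measure.pi fun _ : V => P).map (fun x => (x i, x j)) = P.prod P := by
  have h := (iIndepFun_sample P).indepFun hij
  rw [ProbabilityTheory.indepFun_iff_map_prod_eq_prod_map_map
    (measurable_pi_apply i).aemeasurable (measurable_pi_apply j).aemeasurable] at h
  rw [h]
  congr 1 <;> exact (measurePreserving_eval (fun _ : V => P) _).map_eq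

theorem measure_sample_pair {V : Type*} [Fintype V] (P : Measure ℝ) [IsProbabilityMeasure P]
    {i j : V} (hij : i ≠ j) {W : Set (ℝ × ℝ)} (hW : MeasurableSet W) :
    (Measure.pi fun _ : V => P) {x | (x i, x j) ∈ W} = P.prod P W := by
  rw [← map_sample_pair P hij, Measure.map_apply (by fun_prop) hW]
  rfl

/-- Given the pair `(x i, x j)`, the independent point `x l` falls into the section of `Z` with
probability at most `η`. -/
theorem measure_sample_triple_le {V : Type*} [Fintype V] (P : Measure ℝ) [IsProbabilityMeasure P]
    {i j l : V} (hij : i ≠ j) (hil : i ≠ l) (hjl : j ≠ l) {W : Set (ℝ × ℝ)}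
    (hW : MeasurableSet W) {Z : Set ((ℝ × ℝ) × ℝ)} (hZ : MeasurableSet Z) {η : ENNReal}
    (hη : ∀ q, P (Prod.mk q ⁻¹' Z) ≤ η) :
    (Measure.pi fun _ : V => P) {x | (x i, x j) ∈ W ∧ ((x i, x j), x l) ∈ Z} ≤
      η * P.prod P W := by
  have h := (iIndepFun_sample P).indepFun_prodMk (by fun_prop) i j l hil hjl
  rw [ProbabilityTheory.indepFun_iff_map_prod_eq_prod_map_map (by fun_prop)
    (measurable_pi_apply l).aemeasurable,
    map_sample_pair P hij, (measurePreserving_eval (fun _ : V => P) l).map_eq] at h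
  have hZ' : MeasurableSet (Prod.fst ⁻¹' W ∩ Z) := (measurable_fst hW).inter hZ
  calc _ = ((P.prod P).prod P) (Prod.fst ⁻¹' W ∩ Z) := by
        rw [← h, Measure.map_apply (by fun_prop) hZ']
        rfl
    _ = ∫⁻ q, P (Prod.mk q ⁻¹' (Prod.fst ⁻¹' W ∩ Z)) ∂(P.prod P) := Measure.prod_apply hZ'
    _ ≤ ∫⁻ q, W.indicator (fun _ => η) q ∂(P.prod P) := by
        refine lintegral_mono fun q => ?_
        by_cases hq : q ∈ W
        · rw [Set.indicator_of_mem hq]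
          exact (measure_mono (by intro z hz; exact hz.2)).trans (hη q)
        · rw [Set.indicator_of_notMem hq]
          have : Prod.mk q ⁻¹' (Prod.fst ⁻¹' W ∩ Z) = ∅ := by
            ext z; simp [hq]
          simp [this]
    _ = η * P.prod P W := by rw [lintegral_indicator_const hW]

/-- The number of edges, with endpoints given by `a` and `b`, whose endpoints are mapped by the
sample into `W`. -/
noncomputable def edgeCount {V ι : Type*} [Fintype ι] (a b : ι → V) (W : Set (ℝ × ℝ))
    (x : V → ℝ) : ℝ :=
  ∑ e, {x : V → ℝ | (x (a e), x (b e)) ∈ W}.indicator 1 x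

theorem measurableSet_edge {V : Type*} {W : Set (ℝ × ℝ)} (hW : MeasurableSet W) (i j : V) :
    MeasurableSet {x : V → ℝ | (x i, x j) ∈ W} :=
  (by fun_prop : Measurable fun x : V → ℝ => (x i, x j)) hW

theorem measurable_edgeCount {V ι : Type*} [Fintype ι] (a b : ι → V) {W : Set (ℝ × ℝ)}
    (hW : MeasurableSet W) : Measurable (edgeCount a b W) :=
  Finset.measurable_fun_sum _ fun _ _ => measurable_one.indicator (measurableSet_edge hW _ _)

section EdgeCount

open ProbabilityTheory

variable {V ι : Type*} [Fintype V] [Fintype ι] (P : Measure ℝ) [IsProbabilityMeasure P]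
  (a b : ι → V) {W : Set (ℝ × ℝ)}

theorem memLp_edge (hW : MeasurableSet W) (i j : V) :
    MemLp ({x : V → ℝ | (x i, x j) ∈ W}.indicator (1 : (V → ℝ) → ℝ)) 2
      (Measure.pi fun _ : V => P) :=
  (memLp_const (1 : ℝ)).indicator (measurableSet_edge hW i j)

theorem memLp_edgeCount (hW : MeasurableSet W) :
    MemLp (edgeCount a b W) 2 (Measure.pi fun _ : V => P) :=
  memLp_finsetSum _ fun _ _ => memLp_edge P hW _ _

theorem integral_edgeCount (hab : ∀ e e', a e ≠ b e') (hW : MeasurableSet W) :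
    ∫ x, edgeCount a b W x ∂(Measure.pi fun _ : V => P) =
      Fintype.card ι * (P.prod P).real W := by
  unfold edgeCount
  rw [integral_finsetSum _ fun e _ => (memLp_edge P hW _ _).integrable (by norm_num)]
  simp_rw [integral_indicator_one (measurableSet_edge hW _ _), measureReal_def,
    measure_sample_pair P (hab _ _) hW]
  simp

/-- Disjoint edges are uncorrelated. Each edge meets at most `D` edges at either end, and two
distinct edges sharing a vertex both land in `W` with probability at most `η` times that of one. -/
theorem variance_edgeCount_le [DecidableEq V] [DecidableEq ι] (hab : ∀ e e', a e ≠ b e')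
    (hinj : ∀ e e', a e = a e' → b e = b e' → e = e') (hW : MeasurableSet W) {D : ℕ}
    (ha : ∀ e, (Finset.univ.filter fun e' => a e = a e').card ≤ D)
    (hb : ∀ e, (Finset.univ.filter fun e' => b e = b e').card ≤ D)
    {η : ℝ} (hη : 0 ≤ η) (hη1 : ∀ y, P {z | (y, z) ∈ W} ≤ ENNReal.ofReal η)
    (hη2 : ∀ y, P {z | (z, y) ∈ W} ≤ ENNReal.ofReal η) :
    Var[edgeCount a b W; Measure.pi fun _ : V => P] ≤
      Fintype.card ι * (P.prod P).real W * (1 + 2 * D * η) := by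
  set p := (P.prod P).real W
  have hp : 0 ≤ p := measureReal_nonneg
  set μ := Measure.pi fun _ : V => P
  let X : ι → (V → ℝ) → ℝ := fun e => {x : V → ℝ | (x (a e), x (b e)) ∈ W}.indicator 1
  have hX : ∀ e, MemLp (X e) 2 μ := fun e => memLp_edge P hW _ _
  have hXint : ∀ e, μ[X e] = p := fun e => by
    simp only [X]
    rw [integral_indicator_one (measurableSet_edge hW _ _), measureReal_def,
      measure_sample_pair P (hab _ _) hW]
    rfl
  have hcov : ∀ e e', cov[X e, X e'; μ] ≤
      μ.real {x | (x (a e), x (b e)) ∈ W ∧ (x (a e'), x (b e')) ∈ W} := by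
    intro e e'
    rw [covariance_eq_sub (hX e) (hX e'), hXint, hXint]
    have : X e * X e' =
        {x : V → ℝ | (x (a e), x (b e)) ∈ W ∧ (x (a e'), x (b e')) ∈ W}.indicator 1 := by
      exact (Set.inter_indicator_one ..).symm
    have hm : MeasurableSet {x : V → ℝ | (x (a e), x (b e)) ∈ W ∧ (x (a e'), x (b e')) ∈ W} :=
      (measurableSet_edge hW _ _).inter (measurableSet_edge hW _ _)
    rw [this, integral_indicator_one hm]
    linarith [mul_nonneg hp hp]
  have htoReal : ∀ {A : Set (V → ℝ)}, μ A ≤ ENNReal.ofReal η * P.prod P W → μ.real A ≤ η * p := by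
    intro A hA
    have := ENNReal.toReal_mono (by finiteness) hA
    rwa [ENNReal.toReal_mul, ENNReal.toReal_ofReal hη] at this
  have hbound : ∀ e e', cov[X e, X e'; μ] ≤ (if e = e' then p else 0) +
      (if a e = a e' then η * p else 0) + (if b e = b e' then η * p else 0) := by
    intro e e'
    have hηp : 0 ≤ η * p := mul_nonneg hη hp
    by_cases h : e = e'
    · subst h
      have := hcov e e
      simp only [and_self] at this
      rw [measureReal_def, measure_sample_pair P (hab _ _) hW] at this
      simp only [if_true]
      have h2 : ((P.prod P) W).toReal = p := rfl
      linarith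
    by_cases h1 : a e = a e'
    · have h2 : b e ≠ b e' := fun h2 => h (hinj _ _ h1 h2)
      simp only [h, h1, h2, if_true, if_false]
      refine (hcov e e').trans ?_
      rw [zero_add, add_zero]
      refine htoReal ?_
      have := measure_sample_triple_le P (hab e e) (hab e e') h2 hW
        (Z := {q | (q.1.1, q.2) ∈ W}) ((by fun_prop : Measurable
          fun q : (ℝ × ℝ) × ℝ => (q.1.1, q.2)) hW) (fun q => hη1 q.1)
      rw [← h1]
      exact this
    by_cases h2 : b e = b e'
    · simp only [h, h1, h2, if_true, if_false]
      refine (hcov e e').trans ?_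
      rw [zero_add, zero_add]
      refine htoReal ?_
      have := measure_sample_triple_le P (hab e e) h1 (hab e' e).symm hW
        (Z := {q | (q.2, q.1.2) ∈ W}) ((by fun_prop : Measurable
          fun q : (ℝ × ℝ) × ℝ => (q.2, q.1.2)) hW) (fun q => hη2 q.2)
      rw [← h2]
      exact this
    · simp only [h, h1, h2, if_false, add_zero]
      have hind := ((iIndepFun_sample (V := V) P).indepFun_prodMk_prodMk (by fun_prop)
        (a e) (b e) (a e') (b e') h1 (hab _ _) (hab _ _).symm h2)
      have hm : Measurable (W.indicator (1 : ℝ × ℝ → ℝ)) := measurable_one.indicator hW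
      exact ((hind.comp hm hm).covariance_eq_zero (hX e) (hX e')).le
  have hvar : Var[edgeCount a b W; μ] = ∑ e, ∑ e', cov[X e, X e'; μ] := variance_fun_sum hX
  rw [hvar]
  calc ∑ e, ∑ e', cov[X e, X e'; μ]
      ≤ ∑ e, ∑ e', ((if e = e' then p else 0) +
      (if a e = a e' then η * p else 0) + (if b e = b e' then η * p else 0)) :=
        Finset.sum_le_sum fun e _ => Finset.sum_le_sum fun e' _ => hbound e e'
    _ ≤ ∑ _e : ι, (p + D * (η * p) + D * (η * p)) := by
        refine Finset.sum_le_sum fun e _ => ?_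
        rw [Finset.sum_add_distrib, Finset.sum_add_distrib]
        simp only [Finset.sum_ite_eq, Finset.mem_univ, if_true, ← Finset.sum_filter,
          Finset.sum_const, nsmul_eq_mul]
        have h1 : (((Finset.univ.filter fun e' => a e = a e').card : ℕ) : ℝ) ≤ D := by
          exact_mod_cast ha e
        have h2 : (((Finset.univ.filter fun e' => b e = b e').card : ℕ) : ℝ) ≤ D := by
          exact_mod_cast hb e
        gcongr
    _ = _ := by
        rw [Finset.sum_const, Finset.card_univ, nsmul_eq_mul]; ring

end EdgeCount

/-! ### Query strategies and the block design -/

theorem exists_queryTree_run_eq {s : ℕ} {Y : Type u} [Nonempty Y] (S : Finset (Fin s)) :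
    ∀ (D : (Fin s → Y) → Bool), (∀ y y', (∀ i ∈ S, y i = y' i) → D y = D y') →
      ∀ q, S.card ≤ q → ∃ t : QueryTree s Y q, ∀ y, t.run y = D y := by
  classical
  induction S using Finset.induction_on with
  | empty =>
    intro D hD q _
    -- With nothing left to query the decision is constant, so any labelling evaluates it.
    exact ⟨.halt (D (Classical.arbitrary _)), fun y => by
      rw [QueryTree.run]; exact hD _ _ (by simp)⟩
  | insert i S hi ih =>
    intro D hD q hq
    rw [Finset.card_insert_of_notMem hi] at hq
    obtain ⟨q, rfl⟩ : ∃ q', q = q' + 1 := ⟨q - 1, by omega⟩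
    have hsub : ∀ v : Y, ∃ t : QueryTree s Y q, ∀ y, t.run y = D (Function.update y i v) := by
      intro v
      refine ih (fun y => D (Function.update y i v)) (fun y y' h => hD _ _ fun j hj => ?_) q
        (by omega)
      by_cases hji : j = i
      · subst hji; simp
      · simp only [Function.update_of_ne hji]
        exact h j ((Finset.mem_insert.1 hj).resolve_left hji)
    choose next hnext using hsub
    exact ⟨.query i next, fun y => by rw [QueryTree.run, hnext, Function.update_eq_self]⟩

/-- No randomness is needed, so the seed space is a single point; the query set depends only on the
unlabeled sample. -/
theorem exists_isTester_of_decision {s q : ℕ} {Y : Type u} [Nonempty Y] [MeasurableSpace Y]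
    (D : (Fin s → ℝ) → (Fin s → Y) → Bool) (S : (Fin s → ℝ) → Finset (Fin s))
    (hS : ∀ x, (S x).card ≤ q) (hD : ∀ x y y', (∀ i ∈ S x, y i = y' i) → D x y = D x y')
    (ε : ℝ) (F : Set (ℝ → Y)) (P : Measure ℝ) [IsProbabilityMeasure P]
    (h : ∀ f : ℝ → Y, Measurable f →
      MeasurableSet {x | D x (fun i => f (x i)) = true} ∧
      (f ∈ F → 2 / 3 ≤ (Measure.pi fun _ => P) {x | D x (fun i => f (x i)) = true}) ∧
      (ENNReal.ofReal ε ≤ distToClass P f F →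
        2 / 3 ≤ (Measure.pi fun _ => P) {x | D x (fun i => f (x i)) = false})) :
    ∃ A : SampleQueryAlgorithm.{u, v} Y s q, A.IsTester ε F P := by
  choose t ht using fun x => exists_queryTree_run_eq (S x) (D x) (hD x) q (hS x)
  let A : SampleQueryAlgorithm.{u, v} Y s q :=
    { Seed := PUnit, seedLaw := Measure.dirac PUnit.unit, strategy := fun _ x => t x }
  have hA : ∀ f b, A.decisionEvent f b = Set.univ ×ˢ {x | D x (fun i => f (x i)) = b} := by
    intro f b
    ext p
    simp [SampleQueryAlgorithm.decisionEvent, A, ht]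
  have hlaw : ∀ f b, A.law P (A.decisionEvent f b) =
      (Measure.pi fun _ => P) {x | D x (fun i => f (x i)) = b} := by
    intro f b
    rw [hA, SampleQueryAlgorithm.law, Measure.prod_prod, measure_univ, one_mul]
  refine ⟨A, fun f hf => ?_⟩
  obtain ⟨h1, h2, h3⟩ := h f hf
  refine ⟨fun b => ?_, fun hF => (hlaw f true).symm ▸ h2 hF, fun hF => (hlaw f false).symm ▸ h3 hF⟩
  rw [hA]
  refine MeasurableSet.univ.prod ?_
  cases b
  · convert h1.compl using 1
    ext x; simp
  · exact h1

/-- The pairs of reals in increasing order and at distance less than `δ`. -/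
def nearPairs (δ : ℝ) : Set (ℝ × ℝ) := {p | p.1 < p.2 ∧ p.2 < p.1 + δ}

theorem measurableSet_nearPairs (δ : ℝ) : MeasurableSet (nearPairs δ) :=
  (measurableSet_lt measurable_fst measurable_snd).inter
    (measurableSet_lt measurable_snd (measurable_fst.add_const δ))

theorem changePairs_subset_nearPairs {Y : Type u} (f : ℝ → Y) (δ : ℝ) :
    changePairs f δ ⊆ nearPairs δ := fun _ h => ⟨h.2.2.1, h.2.2.2.1⟩

theorem uniform01_le_volume (A : Set ℝ) : uniform01 A ≤ volume A := by
  rw [uniform01_apply]; exact measure_mono Set.inter_subset_left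

theorem uniform01_nearPairs_right (δ y : ℝ) :
    uniform01 {z | (y, z) ∈ nearPairs δ} ≤ ENNReal.ofReal δ := by
  refine (uniform01_le_volume _).trans ?_
  have : {z | (y, z) ∈ nearPairs δ} = Set.Ioo y (y + δ) := rfl
  simp [this]

theorem uniform01_nearPairs_left (δ y : ℝ) :
    uniform01 {z | (z, y) ∈ nearPairs δ} ≤ ENNReal.ofReal δ := by
  refine (uniform01_le_volume _).trans ?_
  have : {z | (z, y) ∈ nearPairs δ} ⊆ Set.Ioo (y - δ) y := fun z hz =>
    ⟨by linarith [hz.2], hz.1⟩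
  exact (measure_mono this).trans (by simp)

theorem prod_nearPairs_le (δ : ℝ) :
    uniform01.prod uniform01 (nearPairs δ) ≤ ENNReal.ofReal δ := by
  rw [Measure.prod_apply (measurableSet_nearPairs δ)]
  refine (lintegral_mono fun y => uniform01_nearPairs_right δ y).trans ?_
  simp

theorem prod_changePairs {Y : Type u} (f : ℝ → Y) (d : ℝ) :
    uniform01.prod uniform01 (changePairs f d) = volume (changePairs f d) := by
  rw [uniform01, Measure.prod_restrict,
    Measure.restrict_apply' (measurableSet_Ioo.prod measurableSet_Ioo), ← Measure.volume_eq_prod]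
  congr 1
  refine Set.inter_eq_left.2 fun p ⟨h1, h2, h3, h4, h5⟩ => ?_
  exact ⟨⟨h1, h3.trans h2⟩, ⟨h1.trans h3, h2⟩⟩

section Blocks

variable {s m L : ℕ} (φ : Fin m × Bool × Fin L ≃ Fin s)

/-- The first endpoint of an edge of the disjoint union of `m` copies of the complete bipartite
graph `K_{L,L}`. -/
def blockFst (e : Fin m × Fin L × Fin L) : Fin s := φ (e.1, false, e.2.1)

/-- The second endpoint of an edge of the disjoint union of `m` copies of the complete bipartite
graph `K_{L,L}`. -/
def blockSnd (e : Fin m × Fin L × Fin L) : Fin s := φ (e.1, true, e.2.2)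

theorem blockFst_ne_blockSnd (e e' : Fin m × Fin L × Fin L) : blockFst φ e ≠ blockSnd φ e' := by
  simp [blockFst, blockSnd]

theorem block_injective (e e' : Fin m × Fin L × Fin L) (h : blockFst φ e = blockFst φ e')
    (h' : blockSnd φ e = blockSnd φ e') : e = e' := by
  simp only [blockFst, blockSnd, EmbeddingLike.apply_eq_iff_eq, Prod.mk.injEq] at h h'
  exact Prod.ext h.1 (Prod.ext h.2.2 h'.2.2)

theorem card_blockFst_eq_le (e : Fin m × Fin L × Fin L) :
    (Finset.univ.filter fun e' => blockFst φ e = blockFst φ e').card ≤ L := by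
  calc _ ≤ ((Finset.univ : Finset (Fin L)).image fun j => (e.1, e.2.1, j)).card := by
        refine Finset.card_le_card fun e' he' => ?_
        simp only [blockFst, EmbeddingLike.apply_eq_iff_eq, Prod.mk.injEq, Finset.mem_filter] at he'
        exact Finset.mem_image.2
          ⟨e'.2.2, by simp, Prod.ext he'.2.1 (Prod.ext he'.2.2.2 rfl)⟩
    _ ≤ _ := Finset.card_image_le.trans (by simp)

theorem card_blockSnd_eq_le (e : Fin m × Fin L × Fin L) :
    (Finset.univ.filter fun e' => blockSnd φ e = blockSnd φ e').card ≤ L := by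
  calc _ ≤ ((Finset.univ : Finset (Fin L)).image fun j => (e.1, j, e.2.2)).card := by
        refine Finset.card_le_card fun e' he' => ?_
        simp only [blockSnd, EmbeddingLike.apply_eq_iff_eq, Prod.mk.injEq, Finset.mem_filter] at he'
        exact Finset.mem_image.2
          ⟨e'.2.1, by simp, Prod.ext he'.2.1 (Prod.ext rfl he'.2.2.2)⟩
    _ ≤ _ := Finset.card_image_le.trans (by simp)

/-- Chebyshev's inequality. Vertices have degree at most `L`, and `L δ ≤ 2` bounds the variance
factor `1 + 2 L δ` by `5`. -/
theorem measure_edgeCount_deviation_le {W : Set (ℝ × ℝ)} (hW : MeasurableSet W) {δ : ℝ}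
    (hδ : 0 ≤ δ) (hWδ : W ⊆ nearPairs δ) (hLδ : L * δ ≤ 2) {r : ℝ} (hr : 0 < r) :
    (Measure.pi fun _ : Fin s => uniform01)
      {x | r ≤ |edgeCount (blockFst φ) (blockSnd φ) W x -
        m * L ^ 2 * (uniform01.prod uniform01).real W|} ≤
      ENNReal.ofReal (5 * (m * L ^ 2 * (uniform01.prod uniform01).real W) / r ^ 2) := by
  have hcard : ((Fintype.card (Fin m × Fin L × Fin L) : ℕ) : ℝ) = m * L ^ 2 := by
    simp only [Fintype.card_prod, Fintype.card_fin]; push_cast; ring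
  have h := ProbabilityTheory.meas_ge_le_variance_div_sq
    (memLp_edgeCount uniform01 (blockFst φ) (blockSnd φ) hW) hr
  rw [integral_edgeCount _ _ _ (blockFst_ne_blockSnd φ) hW, hcard] at h
  refine h.trans (ENNReal.ofReal_le_ofReal ?_)
  have hv := variance_edgeCount_le uniform01 (blockFst φ) (blockSnd φ) (blockFst_ne_blockSnd φ)
    (block_injective φ) hW (card_blockFst_eq_le φ) (card_blockSnd_eq_le φ) hδ
    (fun y => (measure_mono (Set.ofPred_subset_ofPred.2 fun _ hz => hWδ hz)).trans (uniform01_nearPairs_right δ y))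
    (fun y => (measure_mono (Set.ofPred_subset_ofPred.2 fun _ hz => hWδ hz)).trans (uniform01_nearPairs_left δ y))
  rw [hcard] at hv
  gcongr
  refine hv.trans ?_
  have : 0 ≤ m * L ^ 2 * (uniform01.prod uniform01).real W := by positivity
  nlinarith

theorem measure_le_edgeCount_nearPairs_le {δ : ℝ} (hδ : 0 ≤ δ) {r : ℝ} (hr : 0 < r) :
    (Measure.pi fun _ : Fin s => uniform01)
      {x | r ≤ edgeCount (blockFst φ) (blockSnd φ) (nearPairs δ) x} ≤
      ENNReal.ofReal (m * L ^ 2 * δ / r) := by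
  have hcard : ((Fintype.card (Fin m × Fin L × Fin L) : ℕ) : ℝ) = m * L ^ 2 := by
    simp only [Fintype.card_prod, Fintype.card_fin]; push_cast; ring
  have hW := measurableSet_nearPairs δ
  have h := mul_meas_ge_le_integral_of_nonneg
    (μ := Measure.pi fun _ : Fin s => uniform01)
    (f := edgeCount (blockFst φ) (blockSnd φ) (nearPairs δ))
    (ae_of_all _ fun x => Finset.sum_nonneg fun e _ =>
      Set.indicator_nonneg (fun _ _ => zero_le_one) _)
    ((memLp_edgeCount uniform01 (blockFst φ) (blockSnd φ) hW).integrable (by norm_num)) r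
  rw [integral_edgeCount _ _ _ (blockFst_ne_blockSnd φ) hW, hcard] at h
  have hp : (uniform01.prod uniform01).real (nearPairs δ) ≤ δ :=
    ENNReal.toReal_le_of_le_ofReal hδ (prod_nearPairs_le δ)
  rw [← ENNReal.ofReal_toReal (measure_ne_top (Measure.pi fun _ : Fin s => uniform01) _)]
  refine ENNReal.ofReal_le_ofReal ?_
  rw [le_div_iff₀ hr, mul_comm]
  refine h.trans ?_
  gcongr

end Blocks

/-! ### The testers -/

open Classical in
/-- Querying only the endpoints of the edges between near sample points, and accepting when the
number of edges along which the label changes is at most `τ` (or when there are too many near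
pairs), yields a tester as soon as the change count separates the two cases. -/
theorem exists_isTester_of_edgeCount {s q m L : ℕ} (φ : Fin m × Bool × Fin L ≃ Fin s)
    (hq : min s (80 * m) ≤ q) {Y : Type u} [Nonempty Y] [MeasurableSpace Y]
    (hY : MeasurableAgreement Y) {δ : ℝ} (hδ : 0 ≤ δ) (hm : 0 < m) (hL : L ^ 2 * δ ≤ 4)
    (τ ε : ℝ) (F : Set (ℝ → Y))
    (h : ∀ f : ℝ → Y, Measurable f →
      (f ∈ F → (Measure.pi fun _ : Fin s => uniform01)
        {x | τ < edgeCount (blockFst φ) (blockSnd φ) (changePairs f δ) x} ≤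
          ENNReal.ofReal (1 / 10)) ∧
      (ENNReal.ofReal ε ≤ distToClass uniform01 f F → (Measure.pi fun _ : Fin s => uniform01)
        {x | edgeCount (blockFst φ) (blockSnd φ) (changePairs f δ) x ≤ τ} ≤
          ENNReal.ofReal (1 / 10))) :
    ∃ A : SampleQueryAlgorithm.{u, v} Y s q, A.IsTester ε F uniform01 := by
  set a := blockFst φ
  set b := blockSnd φ
  let N : (Fin s → ℝ) → ℝ := edgeCount a b (nearPairs δ)
  have hN : Measurable N := measurable_edgeCount a b (measurableSet_nearPairs δ)
  -- Overflow can occur only if `q < s`, so the passive tester never needs it.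
  let overflow : (Fin s → ℝ) → Prop := fun x => q < s ∧ (q : ℝ) < 2 * N x
  let near : (Fin s → ℝ) → Finset (Fin m × Fin L × Fin L) := fun x =>
    Finset.univ.filter fun e => (x (a e), x (b e)) ∈ nearPairs δ
  have hnear : ∀ x, N x = (near x).card := by
    intro x
    simp only [N, near, edgeCount, Finset.card_filter, Set.indicator_apply, Set.mem_ofPred_eq]
    push_cast
    rfl
  let change : (Fin s → ℝ) → (Fin s → Y) → ℝ := fun x y => ∑ e,
    if 0 < x (a e) ∧ x (b e) < 1 ∧ (x (a e), x (b e)) ∈ nearPairs δ ∧ y (a e) ≠ y (b e) then 1 else 0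
  have hchange : ∀ (f : ℝ → Y) x, change x (fun i => f (x i)) =
      edgeCount a b (changePairs f δ) x := by
    intro f x
    refine Finset.sum_congr rfl fun e _ => ?_
    simp only [Set.indicator_apply, changePairs, nearPairs, Set.mem_ofPred_eq, and_assoc]
    rfl
  have hset : ∀ (f : ℝ → Y), {x | decide (overflow x ∨ change x (fun i => f (x i)) ≤ τ) = true} =
      {x | overflow x} ∪ {x | edgeCount a b (changePairs f δ) x ≤ τ} := by
    intro f; ext x; simp [hchange]
  have hover : MeasurableSet {x | overflow x} :=
    (MeasurableSet.const _).inter (measurableSet_lt measurable_const (hN.const_mul 2))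
  refine exists_isTester_of_decision (fun x y => decide (overflow x ∨ change x y ≤ τ))
    (fun x => if overflow x then ∅ else (near x).image a ∪ (near x).image b) ?_ ?_ ε F uniform01 ?_
  · intro x
    by_cases ho : overflow x
    · simp [ho]
    simp only [ho, if_false]
    by_cases hqs : q < s
    · have : 2 * N x ≤ q := by
        by_contra hc
        exact ho ⟨hqs, not_le.1 hc⟩
      rw [hnear] at this
      have h2 : 2 * (near x).card ≤ q := by exact_mod_cast this
      have h3 := Finset.card_union_le ((near x).image a) ((near x).image b)
      have h4 : ((near x).image a).card ≤ (near x).card := Finset.card_image_le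
      have h5 : ((near x).image b).card ≤ (near x).card := Finset.card_image_le
      omega
    · exact (Finset.card_le_univ _).trans (by simpa using hqs)
  · intro x y y' hyy
    by_cases ho : overflow x
    · simp [ho]
    simp only [ho, if_false, false_or] at hyy ⊢
    have : change x y = change x y' := by
      refine Finset.sum_congr rfl fun e _ => ?_
      by_cases he : (x (a e), x (b e)) ∈ nearPairs δ
      · have he' : e ∈ near x := by simp [near, he]
        rw [hyy _ (Finset.mem_union_left _ (Finset.mem_image_of_mem a he')),
          hyy _ (Finset.mem_union_right _ (Finset.mem_image_of_mem b he'))]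
      · simp [he]
    rw [this]
  · intro f hf
    obtain ⟨hyes, hno⟩ := h f hf
    have hW := measurableSet_changePairs hY hf δ
    have hT := measurable_edgeCount a b hW
    have hle : MeasurableSet {x | edgeCount a b (changePairs f δ) x ≤ τ} :=
      measurableSet_le hT measurable_const
    have hacc : MeasurableSet {x | decide (overflow x ∨ change x (fun i => f (x i)) ≤ τ) = true} := by
      rw [hset]; exact hover.union hle
    have hsub : ∀ r : ℝ, 0 ≤ r → r ≤ 1 / 3 → (2 / 3 : ENNReal) ≤ 1 - ENNReal.ofReal r := by
      intro r hr hr3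
      rw [← ENNReal.ofReal_one, ← ENNReal.ofReal_sub _ hr]
      have : (2 / 3 : ENNReal) = ENNReal.ofReal (2 / 3) := by
        rw [ENNReal.ofReal_div_of_pos (by norm_num)]; simp
      rw [this]
      exact ENNReal.ofReal_le_ofReal (by linarith)
    refine ⟨hacc, fun hF => ?_, fun hF => ?_⟩
    · rw [hset]
      refine le_trans ?_ (measure_mono Set.subset_union_right)
      have hc := prob_compl_eq_one_sub (μ := Measure.pi fun _ : Fin s => uniform01) hle.compl
      rw [compl_compl] at hc
      rw [hc]
      refine (hsub (1 / 10) (by norm_num) (by norm_num)).trans (tsub_le_tsub_left ?_ _)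
      have hgt : {x | edgeCount a b (changePairs f δ) x ≤ τ}ᶜ =
          {x | τ < edgeCount a b (changePairs f δ) x} := by
        ext x
        exact not_le (a := edgeCount a b (changePairs f δ) x) (b := τ)
      rw [hgt]
      exact hyes hF
    · have hrej : {x | decide (overflow x ∨ change x (fun i => f (x i)) ≤ τ) = false} =
          {x | decide (overflow x ∨ change x (fun i => f (x i)) ≤ τ) = true}ᶜ := by
        ext x; simp
      rw [hrej, prob_compl_eq_one_sub hacc, hset]
      refine (hsub (1 / 10 + 1 / 10) (by norm_num) (by norm_num)).trans (tsub_le_tsub_left ?_ _)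
      refine (measure_union_le _ _).trans ?_
      rw [ENNReal.ofReal_add (by norm_num) (by norm_num)]
      refine add_le_add ?_ (hno hF)
      have hmR : (0 : ℝ) < m := by exact_mod_cast hm
      -- Overflow means more than `40 m` near edges, while at most `m L² δ ≤ 4 m` are expected;
      -- Markov's inequality gives `1 / 10`.
      have hov : {x | overflow x} ⊆ {x | 40 * (m : ℝ) ≤ edgeCount a b (nearPairs δ) x} := by
        intro x ⟨h1, h2⟩
        have : 80 * m ≤ q := by
          rcases min_le_iff.1 hq with h | h
          · omega
          · exact h
        have : 80 * (m : ℝ) ≤ q := by exact_mod_cast this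
        show 40 * (m : ℝ) ≤ N x
        linarith
      refine (measure_mono hov).trans
        ((measure_le_edgeCount_nearPairs_le φ hδ (by positivity)).trans
          (ENNReal.ofReal_le_ofReal ?_))
      rw [div_le_iff₀ (by positivity)]
      nlinarith

/-- The threshold `τ` is halfway between the two bounds on the mean count, at distance `r` from
each. The sizes of `m` and `L` make `r²` more than a hundred times `a`, the scale of the mean. -/
theorem measure_edgeCount_changePairs {Y : Type u} [Nonempty Y] [MeasurableSpace Y]
    (hY : MeasurableAgreement Y) {s m L k : ℕ} (φ : Fin m × Bool × Fin L ≃ Fin s) (hk : 1 ≤ k)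
    {ε δ : ℝ} (hε : 0 < ε) (hε1 : ε < 1 / 2) (hδ : δ = ε ^ 2 / (80 * k))
    (hm : 10 ^ 6 / ε ^ 4 ≤ m) (hLδ : L * δ ≤ 2) (hL : 1 ≤ L ^ 2 * δ) {τ : ℝ}
    (hτ : τ = m * L ^ 2 * ((k - 1 + 3 * k * ε / 16) * δ ^ 2 / 2)) (f : ℝ → Y) (hf : Measurable f) :
    (f ∈ piecewiseClass k (constantFunctions Y) → (Measure.pi fun _ : Fin s => uniform01)
      {x | τ < edgeCount (blockFst φ) (blockSnd φ) (changePairs f δ) x} ≤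
        ENNReal.ofReal (1 / 10)) ∧
    (ENNReal.ofReal ε ≤ distToClass uniform01 f (piecewiseClass k (constantFunctions Y)) →
      (Measure.pi fun _ : Fin s => uniform01)
      {x | edgeCount (blockFst φ) (blockSnd φ) (changePairs f δ) x ≤ τ} ≤
        ENNReal.ofReal (1 / 10)) := by
  have hkR : (1 : ℝ) ≤ k := by exact_mod_cast hk
  have hδ0 : 0 < δ := by rw [hδ]; positivity
  have hkδ : k * δ = ε ^ 2 / 80 := by rw [hδ]; field_simp
  have hW := measurableSet_changePairs hY hf δ
  have hdev := fun r hr => measure_edgeCount_deviation_le φ hW hδ0.le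
    (changePairs_subset_nearPairs f δ) hLδ (r := r) hr
  set p := (uniform01.prod uniform01).real (changePairs f δ) with hp
  have hpv : volume (changePairs f δ) = ENNReal.ofReal p := by
    rw [hp, measureReal_def, ENNReal.ofReal_toReal (measure_ne_top _ _), prod_changePairs]
  have hp0 : 0 ≤ p := measureReal_nonneg
  have hm0 : (0 : ℝ) < m := lt_of_lt_of_le (by positivity) hm
  set M : ℝ := m * L ^ 2 with hM
  set a : ℝ := M * (k * δ ^ 2) with ha
  have ha1 : 12500 ≤ ε ^ 2 * a := by
    have h1 : ε ^ 2 * a = m * (L ^ 2 * δ) * (k * δ) * ε ^ 2 := by rw [ha, hM]; ring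
    rw [h1, hkδ]
    rw [div_le_iff₀ (by positivity)] at hm
    calc (12500 : ℝ) = 10 ^ 6 * 1 / 80 := by norm_num
      _ ≤ (m * ε ^ 4) * (L ^ 2 * δ) / 80 := by gcongr
      _ = _ := by ring
  have ha0 : 0 < a := by
    by_contra hc
    nlinarith [sq_nonneg ε]
  have hM0 : 0 < M := by
    by_contra hc
    have : a ≤ 0 := mul_nonpos_of_nonpos_of_nonneg (not_lt.1 hc) (by positivity)
    linarith
  set r : ℝ := 3 * ε * a / 32 with hr
  have hr0 : 0 < r := by positivity
  have hτr : τ = M * (((k : ℝ) - 1) * δ ^ 2 / 2) + r := by rw [hτ, hr, ha]; ring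
  have hτr2 : M * ((k - 1 + 3 * k * ε / 8) * δ ^ 2 / 2) = τ + r := by rw [hτ, hr, ha]; ring
  have hr2 : 9 * 12500 / 1024 * a ≤ r ^ 2 := by
    have : r ^ 2 = 9 / 1024 * (ε ^ 2 * a) * a := by rw [hr]; ring
    rw [this]
    have := mul_le_mul_of_nonneg_right ha1 ha0.le
    linarith
  refine ⟨fun hF => ?_, fun hF => ?_⟩
  · have hpk : p ≤ ((k : ℝ) - 1) * δ ^ 2 / 2 := by
      have := volume_changePairs_le hY hf hk hF hδ0.le
      rw [hpv] at this
      exact (ENNReal.ofReal_le_ofReal_iff (by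
        have : (0 : ℝ) ≤ k - 1 := by linarith
        positivity)).1 this
    have hMp : M * p ≤ M * (((k : ℝ) - 1) * δ ^ 2 / 2) := by gcongr
    have hMa : M * p ≤ a / 2 := by
      refine hMp.trans ?_
      rw [ha]
      have : 0 ≤ M * δ ^ 2 := by positivity
      nlinarith
    refine (measure_mono fun x hx => ?_).trans ((hdev r hr0).trans (ENNReal.ofReal_le_ofReal ?_))
    · have hx' : τ < edgeCount (blockFst φ) (blockSnd φ) (changePairs f δ) x := hx
      refine le_trans (b := edgeCount (blockFst φ) (blockSnd φ) (changePairs f δ) x - M * p) ?_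
        (le_abs_self _)
      linarith
    · rw [div_le_iff₀ (by positivity)]
      linarith
  · have hpk : (k - 1 + 3 * k * ε / 8) * δ ^ 2 / 2 ≤ p := by
      have := le_volume_changePairs hY hf hk hε hε1 hF hδ
      rw [hpv] at this
      exact (ENNReal.ofReal_le_ofReal_iff hp0).1 this
    have hMp : τ + r ≤ M * p := by rw [← hτr2]; gcongr
    have hτa : τ ≤ a := by
      rw [hτ, ha]
      have : (k - 1 + 3 * k * ε / 16) * δ ^ 2 / 2 ≤ k * δ ^ 2 := by
        have h1 : k - 1 + 3 * k * ε / 16 ≤ 2 * (k : ℝ) := by nlinarith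
        have := mul_le_mul_of_nonneg_right h1 (sq_nonneg δ)
        linarith
      gcongr
    have ht0 : r ≤ M * p - τ := by linarith
    -- For far `f` the mean may be arbitrarily large, and the variance with it, so the deviation
    -- used is the actual gap `t` and not `r`.
    set t := M * p - τ with ht
    refine (measure_mono fun x hx => ?_).trans
      ((hdev t (by linarith)).trans (ENNReal.ofReal_le_ofReal ?_))
    · have hx' : edgeCount (blockFst φ) (blockSnd φ) (changePairs f δ) x ≤ τ := hx
      refine le_trans (b := -(edgeCount (blockFst φ) (blockSnd φ) (changePairs f δ) x - M * p)) ?_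
        (neg_le_abs _)
      linarith
    · have ht00 : 0 < t := by linarith
      rw [div_le_iff₀ (by positivity)]
      have h1 : M * p = τ + t := by rw [ht]; ring
      have hr3 : 1000 ≤ r := by
        have h2 : ε * (ε * a) ≤ 1 / 2 * (ε * a) := by gcongr
        have h3 : ε ^ 2 * a = ε * (ε * a) := by ring
        rw [hr, show 3 * ε * a / 32 = 3 / 32 * (ε * a) by ring]
        linarith
      have h2 : r ^ 2 ≤ t ^ 2 := by gcongr
      have h3 : 1000 * t ≤ t ^ 2 := by
        rw [sq]; exact mul_le_mul_of_nonneg_right (hr3.trans ht0) ht00.le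
      rw [h1]
      linarith

/-- Taking `L` about `δ ^ (-1/2)`, of order `√k / ε`, puts `L² δ` between `1` and `4`. The sample
size `2 m L` is then of order `√k / ε⁵`, and `80 m` queries suffice. -/
theorem exists_piecewiseConstant_testers {Y : Type u} [Nonempty Y] [MeasurableSpace Y]
    (hY : MeasurableAgreement Y) {k : ℕ} (hk : 1 ≤ k) {ε : ℝ} (hε : 0 < ε) (hε1 : ε < 1 / 2) :
    ∃ s : ℕ, (s : ℝ) ≤ 2 * 10 ^ 8 * (√(k : ℝ) / ε ^ 5) ∧
      (∃ q : ℕ, q ≤ s ∧ (q : ℝ) ≤ 2 * 10 ^ 8 * (1 / ε ^ 4) ∧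
        ∃ A : SampleQueryAlgorithm.{u, v} Y s q,
          A.IsTester ε (piecewiseClass k (constantFunctions Y)) uniform01) ∧
      (∃ A : SampleQueryAlgorithm.{u, v} Y s s,
        A.IsTester ε (piecewiseClass k (constantFunctions Y)) uniform01) := by
  have hkR : (1 : ℝ) ≤ k := by exact_mod_cast hk
  obtain ⟨δ, hδ⟩ : ∃ δ, δ = ε ^ 2 / (80 * k) := ⟨_, rfl⟩
  have hδ0 : 0 < δ := by rw [hδ]; positivity
  have hkδ : k * δ = ε ^ 2 / 80 := by rw [hδ]; field_simp
  have hδ1 : δ < 1 := by nlinarith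
  set w := √δ with hw
  have hw0 : 0 < w := Real.sqrt_pos.2 hδ0
  have hww : w * w = δ := Real.mul_self_sqrt hδ0.le
  have hw1 : w < 1 := by nlinarith
  set m := ⌈10 ^ 6 / ε ^ 4⌉₊
  set L := ⌈1 / w⌉₊
  have hm : 10 ^ 6 / ε ^ 4 ≤ (m : ℝ) := Nat.le_ceil _
  have hε4 : ε ^ 4 ≤ 1 := pow_le_one₀ hε.le (by linarith)
  have hm0 : 0 < m := Nat.ceil_pos.2 (by positivity)
  have hm2 : (m : ℝ) ≤ 2 * 10 ^ 6 / ε ^ 4 := by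
    have h1 : (m : ℝ) ≤ 10 ^ 6 / ε ^ 4 + 1 := (Nat.ceil_lt_add_one (by positivity)).le
    have h2 : (1 : ℝ) ≤ 10 ^ 6 / ε ^ 4 := by rw [le_div_iff₀ (by positivity)]; linarith
    linarith [show 2 * 10 ^ 6 / ε ^ 4 = 10 ^ 6 / ε ^ 4 + 10 ^ 6 / ε ^ 4 by ring]
  have hL1 : 1 ≤ L * w := by rw [← div_le_iff₀ hw0]; exact Nat.le_ceil _
  have hL2 : L * w ≤ 1 + w := by
    have h1 : (L : ℝ) ≤ 1 / w + 1 := (Nat.ceil_lt_add_one (by positivity)).le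
    have := mul_le_mul_of_nonneg_right h1 hw0.le
    rwa [add_mul, one_div_mul_cancel hw0.ne', one_mul] at this
  have hLδ : L * δ ≤ 2 := by rw [← hww]; nlinarith
  have hLsq : (L : ℝ) ^ 2 * δ = (L * w) ^ 2 := by rw [← hww]; ring
  have hL4 : (L : ℝ) ^ 2 * δ ≤ 4 := by rw [hLsq]; nlinarith
  have hLge : 1 ≤ (L : ℝ) ^ 2 * δ := by rw [hLsq]; nlinarith
  let s := m * (2 * L)
  have hcard : Fintype.card (Fin m × Bool × Fin L) = s := by simp [s]
  let φ : Fin m × Bool × Fin L ≃ Fin s := Fintype.equivFinOfCardEq hcard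
  have htester := fun (q : ℕ) (hq : min s (80 * m) ≤ q) =>
    exists_isTester_of_edgeCount.{u, v} φ hq hY hδ0.le hm0 hL4 _ ε
      (piecewiseClass k (constantFunctions Y))
      (measure_edgeCount_changePairs hY φ hk hε hε1 hδ hm hLδ hLge rfl)
  refine ⟨s, ?_, ⟨min s (80 * m), min_le_left _ _, ?_, htester _ le_rfl⟩,
    htester s (min_le_left _ _)⟩
  · have hsk : ε ≤ 9 * √k * w := by
      have h1 : ε ^ 2 ≤ (9 * √k * w) ^ 2 := by
        rw [mul_pow, mul_pow, Real.sq_sqrt (by positivity), sq w, hww]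
        nlinarith
      exact (sq_le_sq₀ hε.le (by positivity)).1 h1
    have h2 : (L : ℝ) * ε ≤ 18 * √k := by
      have : (L : ℝ) * ε ≤ L * (9 * √k * w) := by gcongr
      have h3 : L * w * (9 * √k) ≤ 2 * (9 * √k) := by gcongr; linarith
      linarith
    rw [mul_div_assoc', le_div_iff₀ (by positivity)]
    rw [le_div_iff₀ (by positivity)] at hm2
    have h4 : (s : ℝ) * ε ^ 5 = 2 * (m * ε ^ 4) * (L * ε) := by simp only [s]; push_cast; ring
    rw [h4]
    calc 2 * (m * ε ^ 4) * (L * ε) ≤ 2 * (2 * 10 ^ 6) * (18 * √k) := by gcongr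
      _ ≤ _ := by
        have := Real.sqrt_nonneg (k : ℝ)
        nlinarith
  · have h1 : ((min s (80 * m) : ℕ) : ℝ) ≤ 80 * m := by exact_mod_cast min_le_right _ _
    refine h1.trans ?_
    have : (80 : ℝ) * (2 * 10 ^ 6 / ε ^ 4) ≤ 2 * 10 ^ 8 * (1 / ε ^ 4) := by
      have h2 : 2 * 10 ^ 6 / ε ^ 4 = 2 * 10 ^ 6 * (1 / ε ^ 4) := by ring
      have h3 : 0 < 1 / ε ^ 4 := by positivity
      rw [h2]
      linarith
    linarith

/-! ### The lower bound for passive testing -/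

/-- A change of `g` is a change of `h` unless `g` and `h` disagree at one of the two endpoints. -/
theorem volume_shiftChange_le_dist0 {Y : Type u} (g h : ℝ → Y) {d : ℝ} (hd : 0 ≤ d) :
    volume (shiftChange g d) ≤ volume (shiftChange h d) +
      (dist0 uniform01 g h + dist0 uniform01 g h) := by
  have hdist : dist0 uniform01 g h = volume ({x | g x ≠ h x} ∩ Set.Ioo 0 1) := uniform01_apply _
  calc volume (shiftChange g d) ≤ volume (shiftChange h d ∪ (({x | g x ≠ h x} ∩ Set.Ioo 0 1) ∪
        (fun x => x + d) ⁻¹' ({x | g x ≠ h x} ∩ Set.Ioo 0 1))) := by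
        refine measure_mono fun x ⟨h1, h2, h3⟩ => ?_
        by_contra hc
        simp only [Set.mem_union, Set.mem_inter_iff, Set.mem_preimage, shiftChange,
          Set.mem_ofPred_eq, Set.mem_Ioo, not_or, not_and, not_not] at hc
        obtain ⟨hc1, hc2, hc3⟩ := hc
        have e1 : g x = h x := by
          by_contra hne
          exact hc2 hne h1 (by linarith)
        have e2 : g (x + d) = h (x + d) := by
          by_contra hne
          exact hc3 hne (by linarith) h2
        exact h3 (by rw [e1, e2, hc1 h1 h2])
    _ ≤ volume (shiftChange h d) + (volume ({x | g x ≠ h x} ∩ Set.Ioo 0 1) +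
        volume ((fun x => x + d) ⁻¹' ({x | g x ≠ h x} ∩ Set.Ioo 0 1))) :=
        (measure_union_le _ _).trans (add_le_add le_rfl (measure_union_le _ _))
    _ = _ := by rw [measure_preimage_add_right, hdist]

/-- The index of the cell of the partition of `(0, 1]` into `k` intervals of length `1 / k`. -/
noncomputable def cell {k : ℕ} (hk : 1 ≤ k) (x : ℝ) : Fin k :=
  ⟨min (⌈k * x⌉₊ - 1) (k - 1), by omega⟩

theorem measurable_cell {k : ℕ} (hk : 1 ≤ k) : Measurable (cell hk) := by
  have h : Measurable fun x : ℝ => ⌈(k : ℝ) * x⌉₊ :=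
    Nat.measurable_ceil.comp (measurable_id.const_mul _)
  exact (Measurable.of_discrete (f := fun n : ℕ => (⟨min (n - 1) (k - 1), by omega⟩ : Fin k))).comp h

theorem cell_eq_of_forall_le {k : ℕ} (hk : 1 ≤ k) {x y : ℝ} (hxy : x ≤ y)
    (h : ∀ j ∈ Finset.Ico 1 k, k * x ≤ (j : ℝ) → k * y ≤ (j : ℝ)) : cell hk x = cell hk y := by
  have hle : ⌈(k : ℝ) * x⌉₊ ≤ ⌈(k : ℝ) * y⌉₊ := Nat.ceil_mono (by gcongr)
  by_contra hne
  have hne' : min (⌈(k : ℝ) * x⌉₊ - 1) (k - 1) ≠ min (⌈(k : ℝ) * y⌉₊ - 1) (k - 1) := fun h =>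
    hne (Fin.ext h)
  -- The truncated subtraction makes the index at least `1` even when `x ≤ 0`.
  have := h (⌈(k : ℝ) * x⌉₊ - 1 + 1) (by simp; omega)
    ((Nat.le_ceil _).trans (by exact_mod_cast (by omega)))
  rw [← Nat.ceil_le] at this
  omega

theorem cell_comp_mem_piecewiseClass {Y : Type u} [Nonempty Y] {k : ℕ} (hk : 1 ≤ k)
    (F : Fin k → Y) : (fun x => F (cell hk x)) ∈ piecewiseClass k (constantFunctions Y) := by
  classical
  have hk0 : (0 : ℝ) < k := by exact_mod_cast hk
  refine CutBy.mem_piecewiseClass hk (T := (Finset.Ico 1 k).image fun j : ℕ => (j : ℝ) / k)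
    (Finset.card_image_le.trans (by simp)) fun x y hxy h => ?_
  refine congrArg F (cell_eq_of_forall_le hk hxy fun j hj hx => ?_)
  have := h _ (Finset.mem_image_of_mem _ hj) (by rw [le_div_iff₀ hk0]; linarith)
  rw [le_div_iff₀ hk0] at this
  linarith

theorem uniform01_cell_le {k : ℕ} (hk : 1 ≤ k) (c : Fin k) :
    uniform01 {x | cell hk x = c} ≤ (k : ENNReal)⁻¹ := by
  have hk0 : (0 : ℝ) < k := by exact_mod_cast hk
  rw [uniform01_apply]
  calc _ ≤ volume (Set.Ioc ((c : ℕ) / k : ℝ) (((c : ℕ) + 1) / k)) := by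
        refine measure_mono fun x ⟨hx, hx0, hx1⟩ => ?_
        have hc : min (⌈(k : ℝ) * x⌉₊ - 1) (k - 1) = c := congrArg Fin.val hx
        have h1 : 0 < ⌈(k : ℝ) * x⌉₊ := Nat.ceil_pos.2 (by positivity)
        have h2 : ⌈(k : ℝ) * x⌉₊ ≤ k := by
          rw [Nat.ceil_le]; nlinarith
        have h3 : ⌈(k : ℝ) * x⌉₊ = c + 1 := by omega
        have h4 := Nat.le_ceil ((k : ℝ) * x)
        have h5 := Nat.ceil_lt_add_one (a := (k : ℝ) * x) (by positivity)
        rw [h3] at h4 h5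
        push_cast at h4 h5
        exact ⟨by rw [div_lt_iff₀ hk0]; linarith, by rw [le_div_iff₀ hk0]; linarith⟩
    _ = _ := by
        rw [Real.volume_Ioc, show (((c : ℕ) : ℝ) + 1) / k - (c : ℕ) / k = (k : ℝ)⁻¹ by ring,
          ENNReal.ofReal_inv_of_pos hk0, ENNReal.ofReal_natCast]

theorem measure_cell_eq_cell_le {V : Type*} [Fintype V] {k : ℕ} (hk : 1 ≤ k) {i j : V}
    (hij : i ≠ j) : (Measure.pi fun _ : V => uniform01) {x | cell hk (x i) = cell hk (x j)} ≤
      (k : ENNReal)⁻¹ := by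
  have hW : MeasurableSet {p : ℝ × ℝ | cell hk p.1 = cell hk p.2} :=
    measurableSet_eq_fun ((measurable_cell hk).comp measurable_fst)
      ((measurable_cell hk).comp measurable_snd)
  have h := measure_sample_pair uniform01 hij hW
  refine h.le.trans ?_
  rw [Measure.prod_apply hW]
  calc _ ≤ ∫⁻ _, (k : ENNReal)⁻¹ ∂uniform01 := by
        refine lintegral_mono fun y => ?_
        refine (measure_mono fun z hz => ?_).trans (uniform01_cell_le hk (cell hk y))
        exact (Eq.symm hz)
    _ = _ := by simp

/-- The parity of the index of the cell of length `1 / (4 * k)`. -/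
noncomputable def fineParity (k : ℕ) (x : ℝ) : Bool := decide (Even ⌈4 * k * x⌉)

/-- A cell consists of four fine intervals, the first of odd index. Shifting an odd fine interval by
its length stays in the cell and flips the parity, so the label changes there. The odd intervals and
their translates cover `(0, 1)` up to the point `1 - d`. -/
theorem half_le_volume_shiftChange {Y : Type u} {k : ℕ} (hk : 1 ≤ k) {lab : Bool → Y}
    (hlab : Function.Injective lab) (b : Fin k → Bool) :
    1 ≤ 2 * volume (shiftChange (fun x => lab (xor (b (cell hk x)) (fineParity k x)))
      (1 / (4 * k))) := by
  have hk0 : (0 : ℝ) < k := by exact_mod_cast hk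
  set d : ℝ := 1 / (4 * k)
  have hd0 : 0 < d := by positivity
  have hkd : 4 * k * d = 1 := by simp only [d]; field_simp
  set g : ℝ → Y := fun x => lab (xor (b (cell hk x)) (fineParity k x))
  have hshift : ∀ x, ⌈4 * k * (x + d)⌉ = ⌈4 * k * x⌉ + 1 := by
    intro x; rw [mul_add, hkd]; exact Int.ceil_add_one _
  have hmem : ∀ x, 0 < x → x + d < 1 → ¬ Even ⌈4 * k * x⌉ → x ∈ shiftChange g d := by
    intro x h0 h1 hodd
    refine ⟨h0, h1, fun heq => ?_⟩
    have hcell : cell hk x = cell hk (x + d) := by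
      refine cell_eq_of_forall_le hk (by linarith) fun j _ hj => ?_
      obtain ⟨i, hi⟩ := Int.not_even_iff_odd.1 hodd
      have h2 : 4 * k * x ≤ ((2 * i + 1 : ℤ) : ℝ) := hi ▸ Int.le_ceil _
      have h3 : ((2 * i : ℤ) : ℝ) < 4 * k * x := by
        rw [← Int.lt_ceil, hi]; omega
      have h4 : ((2 * i : ℤ) : ℝ) < ((4 * j : ℤ) : ℝ) := by push_cast at h3 ⊢; linarith
      have h5 : 2 * i + 1 ≤ 4 * (j : ℤ) - 1 := by
        have := Int.cast_lt.1 h4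
        omega
      have h6 : ((2 * i + 1 : ℤ) : ℝ) ≤ ((4 * j - 1 : ℤ) : ℝ) := Int.cast_le.2 h5
      push_cast at h2 h6
      linarith
    have h2 := hlab heq
    have hp : fineParity k (x + d) = !fineParity k x := by
      simp only [fineParity, hshift, Int.even_add_one, decide_not]
    rw [← hcell, hp] at h2
    cases b (cell hk x) <;> cases fineParity k x <;> simp at h2
  have hcover : Set.Ioo (0 : ℝ) 1 ⊆ (shiftChange g d ∪ (fun x => x - d) ⁻¹' shiftChange g d) ∪
      {1 - d} := by
    intro x ⟨h0, h1⟩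
    by_cases hev : Even ⌈4 * k * x⌉
    · refine Or.inl (Or.inr (hmem (x - d) ?_ (by linarith) ?_))
      · have hpos : 0 < ⌈4 * k * x⌉ := Int.ceil_pos.2 (by positivity)
        have h2 : 1 < ⌈4 * k * x⌉ := by
          obtain ⟨i, hi⟩ := hev
          omega
        rw [Int.lt_ceil] at h2
        push_cast at h2
        have : 4 * k * d < 4 * k * x := by linarith
        have := lt_of_mul_lt_mul_left this (by positivity)
        linarith
      · have h2 := hshift (x - d)
        rw [sub_add_cancel] at h2
        rw [h2, Int.even_add_one] at hev
        exact hev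
    · have hle : ⌈4 * k * x⌉ ≤ 4 * k := by
        rw [Int.ceil_le]; push_cast; nlinarith
      have h2 : ⌈4 * k * x⌉ ≤ 4 * k - 1 := by
        obtain ⟨i, hi⟩ := Int.not_even_iff_odd.1 hev
        omega
      rw [Int.ceil_le] at h2
      push_cast at h2
      have h3 : 4 * k * (x + d) ≤ 4 * k * 1 := by rw [mul_add, hkd]; linarith
      have h4 := le_of_mul_le_mul_left h3 (by positivity)
      rcases h4.lt_or_eq with h5 | h5
      · exact Or.inl (Or.inl (hmem x h0 h5 hev))
      · exact Or.inr (by rw [Set.mem_singleton_iff]; linarith)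
  calc (1 : ENNReal) = volume (Set.Ioo (0 : ℝ) 1) := by simp
    _ ≤ _ := measure_mono hcover
    _ ≤ volume (shiftChange g d) + volume ((fun x => x - d) ⁻¹' shiftChange g d) +
        volume {1 - d} :=
        (measure_union_le _ _).trans (add_le_add (measure_union_le _ _) le_rfl)
    _ = _ := by
        have : volume ((fun x => x - d) ⁻¹' shiftChange g d) = volume (shiftChange g d) := by
          simp_rw [sub_eq_add_neg]; exact measure_preimage_add_right _ _ _
        rw [this, Real.volume_singleton, add_zero, two_mul]

/-- A member of the class changes on measure at most `1 / 4` under this shift. Passing from it to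
`g`, at distance `D`, adds at most `2 D`; hence `1 / 2 ≤ 1 / 4 + 2 D`. -/
theorem le_distToClass_of_half_le {Y : Type u} {k : ℕ} (hk : 1 ≤ k) {g : ℝ → Y}
    (hg : 1 ≤ 2 * volume (shiftChange g (1 / (4 * k)))) {ε : ℝ} (hε : ε < 1 / 8) :
    ENNReal.ofReal ε ≤ distToClass uniform01 g (piecewiseClass k (constantFunctions Y)) := by
  refine le_iInf₂ fun h hh => ?_
  have hk0 : (0 : ℝ) < k := by exact_mod_cast hk
  obtain ⟨T, hT, hcut⟩ := exists_cutBy_of_mem_piecewiseClass hk hh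
  have h1 := hcut.volume_shiftChange_le (e := 1 / (4 * k)) (by positivity)
  have h2 : (T.card : ENNReal) * ENNReal.ofReal (1 / (4 * k)) ≤ ENNReal.ofReal (1 / 4) := by
    rw [← ENNReal.ofReal_natCast, ← ENNReal.ofReal_mul (by positivity)]
    refine ENNReal.ofReal_le_ofReal ?_
    rw [mul_one_div, div_le_iff₀ (by positivity)]
    have : (T.card : ℝ) ≤ k := by exact_mod_cast hT.trans (by omega)
    linarith
  have h3 := volume_shiftChange_le_dist0 g h (d := 1 / (4 * k)) (by positivity)
  have h4 := hg.trans (mul_le_mul_right (h3.trans (add_le_add (h1.trans h2) le_rfl)) 2)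
  have hfin : dist0 uniform01 g h ≠ ⊤ := measure_ne_top _ _
  rw [← ENNReal.ofReal_toReal hfin] at h4 ⊢
  set D := (dist0 uniform01 g h).toReal
  have hD : 0 ≤ D := ENNReal.toReal_nonneg
  rw [← ENNReal.ofReal_add hD hD, ← ENNReal.ofReal_add (by norm_num) (by positivity),
    show (2 : ENNReal) = ENNReal.ofReal 2 by simp, ← ENNReal.ofReal_mul (by norm_num),
    ← ENNReal.ofReal_one, ENNReal.ofReal_le_ofReal_iff (by positivity)] at h4
  exact ENNReal.ofReal_le_ofReal (by linarith)

/-- When the points lie in distinct cells, their parities define one bit per occupied cell, and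
adding these is a bijection of the bit vectors. -/
theorem sum_bits_comp_eq {V β : Type*} [AddCommMonoid β] {Y : Type u} {k : ℕ} (hk : 1 ≤ k)
    (lab : Bool → Y) (x : V → ℝ) (hx : Function.Injective fun i => cell hk (x i))
    (Φ : (V → Y) → β) :
    ∑ b : Fin k → Bool, Φ (fun i => lab (b (cell hk (x i)))) =
      ∑ b : Fin k → Bool, Φ (fun i => lab (xor (b (cell hk (x i))) (fineParity k (x i)))) := by
  classical
  let r : Fin k → Bool := fun c => if h : ∃ i, cell hk (x i) = c then fineParity k (x h.choose)
    else false
  have hr : ∀ i, r (cell hk (x i)) = fineParity k (x i) := by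
    intro i
    have h : ∃ j, cell hk (x j) = cell hk (x i) := ⟨i, rfl⟩
    simp only [r, dif_pos h]
    rw [hx h.choose_spec]
  have hinv : Function.Involutive fun (b : Fin k → Bool) c => xor (b c) (r c) := by
    intro b; ext c; simp
  symm
  refine Fintype.sum_equiv hinv.toPerm _ _ fun b => ?_
  simp [Function.Involutive.coe_toPerm, hr]

theorem le_of_isTester_piecewiseConstant {Y : Type u} [MeasurableSpace Y] [Nontrivial Y] {k : ℕ}
    (hk : 1 ≤ k) {ε : ℝ} (hε : ε < 1 / 8) {s q : ℕ} (A : SampleQueryAlgorithm.{u, v} Y s q)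
    (hA : A.IsTester ε (piecewiseClass k (constantFunctions Y)) uniform01) :
    (k : ℝ) ≤ 3 * (s : ℝ) ^ 2 := by
  classical
  obtain ⟨y₀, y₁, hy⟩ := exists_pair_ne Y
  let lab : Bool → Y := fun b => if b then y₁ else y₀
  have hlab : Function.Injective lab := by
    intro a b; cases a <;> cases b <;> simp [lab, hy, hy.symm]
  let f : (Fin k → Bool) → ℝ → Y := fun b x => lab (b (cell hk x))
  let g : (Fin k → Bool) → ℝ → Y := fun b x => lab (xor (b (cell hk x)) (fineParity k x))
  have hfm : ∀ b, Measurable (f b) := fun b =>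
    (Measurable.of_discrete (f := fun c => lab (b c))).comp (measurable_cell hk)
  have hgm : ∀ b, Measurable (g b) := by
    intro b
    have hceil : Measurable fun x : ℝ => ⌈4 * (k : ℝ) * x⌉ :=
      Int.measurable_ceil.comp (measurable_id.const_mul _)
    exact (Measurable.of_discrete
      (f := fun p : Fin k × ℤ => lab (xor (b p.1) (decide (Even p.2))))).comp
      ((measurable_cell hk).prodMk hceil)
  have hlaw : IsProbabilityMeasure (A.law uniform01) := by
    unfold SampleQueryAlgorithm.law; infer_instance
  have hyes : ∀ b, 2 / 3 ≤ A.law uniform01 (A.decisionEvent (f b) true) := fun b =>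
    (hA _ (hfm b)).2.1 (cell_comp_mem_piecewiseClass hk fun c => lab (b c))
  have hno : ∀ b, A.law uniform01 (A.decisionEvent (g b) true) ≤ 1 / 3 := by
    intro b
    obtain ⟨hm, -, h2⟩ := hA _ (hgm b)
    have h3 := h2 (le_distToClass_of_half_le hk (half_le_volume_shiftChange hk hlab b) hε)
    have hcompl : A.decisionEvent (g b) true = (A.decisionEvent (g b) false)ᶜ := by
      ext p; simp [SampleQueryAlgorithm.decisionEvent]
    rw [hcompl, prob_compl_eq_one_sub (hm false)]
    refine (tsub_le_tsub_left h3 1).trans ?_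
    rw [tsub_le_iff_right, ENNReal.div_add_div_same]
    norm_num
    rw [ENNReal.div_self] <;> simp
  let bad : Set (A.Seed × (Fin s → ℝ)) :=
    ⋃ p ∈ (Finset.univ : Finset (Fin s)).offDiag,
      Set.univ ×ˢ {x | cell hk (x p.1) = cell hk (x p.2)}
  have hbad : MeasurableSet bad := by
    refine Finset.measurableSet_biUnion _ fun p _ => MeasurableSet.univ.prod ?_
    exact measurableSet_eq_fun ((measurable_cell hk).comp (measurable_pi_apply _))
      ((measurable_cell hk).comp (measurable_pi_apply _))
  have hbadP : A.law uniform01 bad ≤ (s * s : ℕ) * (k : ENNReal)⁻¹ := by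
    calc A.law uniform01 bad ≤ ∑ p ∈ (Finset.univ : Finset (Fin s)).offDiag,
          A.law uniform01 (Set.univ ×ˢ {x | cell hk (x p.1) = cell hk (x p.2)}) :=
          measure_biUnion_finset_le _ _
      _ ≤ ∑ p ∈ (Finset.univ : Finset (Fin s)).offDiag, (k : ENNReal)⁻¹ := by
          refine Finset.sum_le_sum fun p hp => ?_
          rw [SampleQueryAlgorithm.law, Measure.prod_prod, measure_univ, one_mul]
          exact measure_cell_eq_cell_le hk (Finset.mem_offDiag.1 hp).2.2
      _ ≤ _ := by
          rw [Finset.sum_const, nsmul_eq_mul, Finset.offDiag_card]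
          gcongr
          simp
  -- Up to the factor `2 ^ k` this compares acceptance under uniform bits: equal off the collision
  -- event, and differing by at most one on it. Integrating gives `2 / 3 ≤ 1 / 3 + s² / k`.
  have hpt : ∀ p, ∑ b, (A.decisionEvent (f b) true).indicator (1 : A.Seed × (Fin s → ℝ) → ENNReal) p ≤
      ∑ b, (A.decisionEvent (g b) true).indicator 1 p + 2 ^ k * bad.indicator 1 p := by
    intro p
    by_cases hp : p ∈ bad
    · refine le_trans ?_ le_add_self
      rw [Set.indicator_of_mem hp, Pi.one_apply, mul_one]
      calc _ ≤ ∑ _b : Fin k → Bool, (1 : ENNReal) :=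
            Finset.sum_le_sum fun b _ =>
              Set.indicator_le_self' (f := (1 : A.Seed × (Fin s → ℝ) → ENNReal))
                (fun _ _ => zero_le) p
        _ = _ := by simp
    · refine le_trans (le_of_eq ?_) le_self_add
      have hinj : Function.Injective fun i => cell hk (p.2 i) := by
        intro i j hij
        by_contra hne
        refine hp (Set.mem_iUnion₂.2 ⟨(i, j), by simpa using hne, ?_⟩)
        exact ⟨trivial, hij⟩
      exact sum_bits_comp_eq hk lab p.2 hinj fun y =>
        Set.indicator {y | (A.strategy p.1 p.2).run y = true} (1 : (Fin s → Y) → ENNReal) y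
  have hint := lintegral_mono (μ := A.law uniform01) hpt
  rw [lintegral_add_right _ ((measurable_one.indicator hbad).const_mul _),
    lintegral_finsetSum _ fun b _ => measurable_one.indicator ((hA _ (hfm b)).1 true),
    lintegral_finsetSum _ fun b _ => measurable_one.indicator ((hA _ (hgm b)).1 true),
    lintegral_const_mul _ (measurable_one.indicator hbad), lintegral_indicator_one hbad] at hint
  simp_rw [fun b => lintegral_indicator_one (μ := A.law uniform01) ((hA _ (hfm b)).1 true),
    fun b => lintegral_indicator_one (μ := A.law uniform01) ((hA _ (hgm b)).1 true)] at hint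
  have hsum : (2 : ENNReal) ^ k * (2 / 3) ≤
      2 ^ k * (1 / 3) + 2 ^ k * ((s * s : ℕ) * (k : ENNReal)⁻¹) := by
    calc (2 : ENNReal) ^ k * (2 / 3) = ∑ _b : Fin k → Bool, (2 / 3 : ENNReal) := by simp
      _ ≤ _ := (Finset.sum_le_sum fun b _ => hyes b).trans hint
      _ ≤ (∑ _b : Fin k → Bool, (1 / 3 : ENNReal)) + 2 ^ k * ((s * s : ℕ) * (k : ENNReal)⁻¹) :=
          add_le_add (Finset.sum_le_sum fun b _ => hno b) (by gcongr)
      _ = _ := by simp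
  rw [← mul_add, ENNReal.mul_le_mul_iff_right (by simp) (by finiteness)] at hsum
  have hk0 : (0 : ℝ) < k := by exact_mod_cast hk
  have hreal := ENNReal.toReal_mono (by
    have : (k : ENNReal) ≠ 0 := by simp; omega
    finiteness) hsum
  rw [ENNReal.toReal_add (by finiteness) (by
    have : (k : ENNReal) ≠ 0 := by simp; omega
    finiteness)] at hreal
  simp only [ENNReal.toReal_div, ENNReal.toReal_mul, ENNReal.toReal_inv, ENNReal.toReal_natCast,
    ENNReal.toReal_ofNat, ENNReal.toReal_one] at hreal
  rw [← div_eq_mul_inv] at hreal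
  have h3 : (1 : ℝ) / 3 ≤ ((s * s : ℕ) : ℝ) / k := by linarith
  rw [le_div_iff₀ hk0] at h3
  push_cast at h3
  linarith [sq (s : ℝ)]

theorem theorem2 :
    ∃ C c : ℝ, 0 < C ∧ 0 < c ∧
      ∀ (Y : Type u) [MeasurableSpace Y] [Nonempty Y], MeasurableAgreement Y →
        ∀ k : ℕ, 1 ≤ k →
          -- upper bounds, for active and for passive testing
          (∀ ε : ℝ, 0 < ε → ε < 1 / 2 →
            ∃ s : ℕ, (s : ℝ) ≤ C * (√(k : ℝ) / ε ^ 5) ∧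
              (∃ q : ℕ, q ≤ s ∧ (q : ℝ) ≤ C * (1 / ε ^ 4) ∧
                ∃ A : SampleQueryAlgorithm.{u, v} Y s q,
                  A.IsTester ε (piecewiseClass k (constantFunctions Y)) uniform01) ∧
              (∃ A : SampleQueryAlgorithm.{u, v} Y s s,
                A.IsTester ε (piecewiseClass k (constantFunctions Y)) uniform01)) ∧
          -- lower bound for passive testing
          (Nontrivial Y → ∀ ε : ℝ, 0 < ε → ε < 1 / 8 →
            ∀ (s : ℕ) (A : SampleQueryAlgorithm.{u, v} Y s s),
              A.IsTester ε (piecewiseClass k (constantFunctions Y)) uniform01 →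
                c * √(k : ℝ) ≤ (s : ℝ)) := by
  refine ⟨2 * 10 ^ 8, 1 / 2, by norm_num, by norm_num, fun Y _ _ hY k hk =>
    ⟨fun ε hε hε1 => exists_piecewiseConstant_testers hY hk hε hε1,
      fun _ ε _ hε s A hA => ?_⟩⟩
  have h := le_of_isTester_piecewiseConstant hk hε A hA
  have h2 : √(k : ℝ) ≤ 2 * s := Real.sqrt_le_iff.2 ⟨by positivity, by nlinarith [sq_nonneg (s : ℝ)]⟩
  linarith
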